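/- Conventions. Let $A$ be a commutative Noetherian ring. A finitely generated $A$-module $M$ is maximal Cohen-Macaulay (MCM) if $\operatorname{depth}_{A_{\mathfrak p}} M_{\mathfrak p} \ge \dim A_{\mathfrak p}$ for every $\mathfrak p \in \operatorname{Spec} A$ (the zero module has depth $\infty$). Let $\mathrm{CM}(A)$ be the category of MCM $A$-modules, and let $\Omega\mathrm{CM}(A)$ be the category of finitely generated $A$-modules $M$ admitting an exact sequence $0 \to M \to F \to X \to 0$ of $A$-modules with $F$ finitely generated free and $X \in \mathrm{CM}(A)$. For an $R$-module $M$, let $\operatorname{tr}_R(M) = \sum_{f \in \operatorname{Hom}_R(M,R)} f(M)$. For an ideal $J$ of $R$, let $\Omega\mathrm{CM}(R,J)$ be the category of those $M \in \Omega\mathrm{CM}(R)$ with $\operatorname{tr}_R(M) \subseteq J$. For $R$-submodules $X, Y$ of the total ring of fractions $\mathrm{Q}(R)$, put $X : Y = \{a \in \mathrm{Q}(R) \mid aY \subseteq X\}$. An ideal is regular if it contains a non-zerodivisor, and it is a trace ideal if it equals $\operatorname{tr}_R(M)$ for some $R$-module $M$. A regular ideal $I$ is stable if $\bigcup_{n \ge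 0} (I^n : I^n) = I : I$. Theorem. Let $(R,\mathfrak m)$ be a Cohen-Macaulay local ring with $\dim R = 1$ such that $\mathrm{Q}(R)$ is a Gorenstein ring. Let $I$ be a regular trace ideal of $R$ that is reflexive as an $R$-module, and let $A = \operatorname{End}_R(I)$, identified with the subring $I : I$ of $\mathrm{Q}(R)$. Then the following hold. (1) Restriction of scalars identifies $\mathrm{CM}(A)$ with a full subcategory of the category of $R$-modules (every $R$-linear map between MCM $A$-modules is $A$-linear), and, as subcategories of the category of finitely generated $R$-modules, $$\Omega\mathrm{CM}(A) \subseteq \Omega\mathrm{CM}(R, I) \subseteq \mathrm{CM}(A),$$ where an $R$-module is regarded as belonging to $\Omega\mathrm{CM}(A)$ or $\mathrm{CM}(A)$ if its $R$-action extends to an $A$-module structure with the respective property. (2) $\Omega\mathrm{CM}(A) = \Omega\mathrm{CM}(R, I)$ if and only if $I$ is stable. (3) Suppose that $R$ admits a fractional canonical ideal $K$, that is, an $R$-submodule $K$ of $\mathrm{Q}(R)$ with $R \subseteq K \subseteq \overline{R}$ that is a canonical module of $R$ (an MCM module of finite injective dimension and of type one), where $\overline{R}$ is the integral closure of $R$ in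 $\mathrm{Q}(R)$. Put $\mathfrak c = R : R[K]$. Then $\Omega\mathrm{CM}(R, I) = \mathrm{CM}(A)$ if and only if $I \subseteq \mathfrak c$, and $I \subseteq \mathfrak c$ if and only if $IK = I$. -/

import Mathlib

universe u

open CategoryTheory

noncomputable section

/-- The depth of a module `M` over a local ring `R`: the supremum of the lengths of the
`M`-regular sequences in the maximal ideal. For finite nonzero `M` over a Noetherian `R` the
condition `M ≠ (x₁, …, xₙ) M` is automatic (Nakayama); the zero module has depth `∞`. -/
def moduleDepth (R : Type u) [CommRing R] [IsLocalRing R]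
    (M : Type u) [AddCommGroup M] [Module R M] : ℕ∞ :=
  ⨆ (rs : List R) (_ : RingTheory.Sequence.IsWeaklyRegular M rs ∧
    ∀ r ∈ rs, r ∈ IsLocalRing.maximalIdeal R), (rs.length : ℕ∞)

/-- A Cohen-Macaulay local ring: Noetherian, local, with depth equal to the Krull dimension. -/
structure IsCMLocalRing (R : Type u) [CommRing R] [IsLocalRing R] : Prop where
  noetherian : IsNoetherianRing R
  depth_eq : ((moduleDepth R R : ℕ∞) : WithBot ℕ∞) = ringKrullDim R

/-- A finite module `M` over `A` is maximal Cohen-Macaulay (MCM) if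
`depth M_𝔭 ≥ dim A_𝔭` for every prime `𝔭` of `A`. -/
structure IsMCM (A : Type u) [CommRing A] (M : Type u) [AddCommGroup M] [Module A M] : Prop where
  finite : Module.Finite A M
  dim_le_depth : ∀ (p : Ideal A) [p.IsPrime],
    ringKrullDim (Localization.AtPrime p) ≤
      ((moduleDepth (Localization.AtPrime p) (LocalizedModule p.primeCompl M) : ℕ∞) : WithBot ℕ∞)

/-- `M` is a first syzygy of an MCM module: there is an exact sequence
`0 → M → F → X → 0` with `F` finite free and `X` MCM. -/
def IsSyzygyOfMCM (A : Type u) [CommRing A] (M : Type u) [AddCommGroup M] [Module A M] : Prop :=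
  Module.Finite A M ∧
  ∃ (F X : Type u) (_ : AddCommGroup F) (_ : AddCommGroup X) (_ : Module A F) (_ : Module A X)
    (f : M →ₗ[A] F) (g : F →ₗ[A] X),
    Module.Free A F ∧ Module.Finite A F ∧ IsMCM A X ∧
      Function.Injective f ∧ Function.Exact f g ∧ Function.Surjective g

/-- A Gorenstein ring: Noetherian, and every localization at a prime has finite injective
dimension over itself. -/
structure IsGorensteinRing (Q : Type u) [CommRing Q] : Prop where
  noetherian : IsNoetherianRing Q
  finite_injectiveDimension : ∀ (p : Ideal Q) [p.IsPrime],
    ∃ n : ℕ, HasInjectiveDimensionLE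
      (ModuleCat.of (Localization.AtPrime p) (Localization.AtPrime p)) n

/-- The trace ideal `tr_R(M)`: the image of the evaluation map `Hom_R(M, R) ⊗ M → R`. -/
def moduleTrace (R : Type u) [CommRing R] (M : Type u) [AddCommGroup M] [Module R M] : Ideal R :=
  LinearMap.range (contractLeft R M)

/-- An ideal is a trace ideal if it is the trace of some module. -/
def IsTraceIdeal {R : Type u} [CommRing R] (I : Ideal R) : Prop :=
  ∃ (M : Type u) (_ : AddCommGroup M) (_ : Module R M), I = moduleTrace R M

/-- An ideal is regular if it contains a non-zerodivisor. -/
def IsRegularIdeal {R : Type u} [CommRing R] (I : Ideal R) : Prop :=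
  ∃ a ∈ I, a ∈ nonZeroDivisors R

/-- The ring `I : I = {x ∈ Q | x I ⊆ I}`, as an `R`-subalgebra of the total ring of fractions `Q`.
For submodules `X`, `Y` of `Q`, Mathlib writes `X / Y` for `X : Y = {x ∈ Q | x Y ⊆ X}`. -/
def colonAlgebra {R : Type u} [CommRing R] (Q : Type u) [CommRing Q] [Algebra R Q]
    (I : Ideal R) : Subalgebra R Q where
  carrier := ((IsLocalization.coeSubmodule Q I / IsLocalization.coeSubmodule Q I :
    Submodule R Q) : Set Q)
  mul_mem' := by
    intro a b ha hb
    rw [SetLike.mem_coe, Submodule.mem_div_iff_forall_mul_mem] at *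
    intro y hy
    rw [mul_assoc]
    exact ha _ (hb _ hy)
  add_mem' := fun ha hb => Submodule.add_mem _ ha hb
  algebraMap_mem' := by
    intro r
    rw [SetLike.mem_coe, Submodule.mem_div_iff_forall_mul_mem]
    intro y hy
    rw [← Algebra.smul_def]
    exact Submodule.smul_mem _ r hy

/-- A (regular) ideal `I` is stable if `R^I = I : I`, where
`R^I = ⋃ₙ (Iⁿ : Iⁿ)` is the blow-up algebra of `I` in the total ring of fractions `Q`. -/
def IsStableIdeal {R : Type u} [CommRing R] (Q : Type u) [CommRing Q] [Algebra R Q]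
    (I : Ideal R) : Prop :=
  (⋃ n : ℕ, (colonAlgebra Q (I ^ n) : Set Q)) = (colonAlgebra Q I : Set Q)

/-- A canonical module of a Cohen-Macaulay local ring `R`: an MCM module of finite injective
dimension and of type one. For MCM modules the type is `dim_k Ext^d(k, C)`, where `d = dim R` and
`k` is the residue field; as the maximal ideal kills this `Ext`, the dimension is the length. -/
structure IsCanonicalModule (R : Type u) [CommRing R] [IsLocalRing R]
    (C : Type u) [AddCommGroup C] [Module R C] : Prop where
  isMCM : IsMCM R C
  finite_injectiveDimension : ∃ n : ℕ, HasInjectiveDimensionLE (ModuleCat.of R C) n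
  type_one : ∃ d : ℕ, ringKrullDim R = ((d : ℕ∞) : WithBot ℕ∞) ∧
    Module.length R (Abelian.Ext.{u} (ModuleCat.of R (IsLocalRing.ResidueField R))
      (ModuleCat.of R C) d) = 1

/-- A fractional canonical ideal: an `R`-submodule `K` of the total ring of fractions `Q` that is a
canonical module of `R` and satisfies `R ⊆ K ⊆ R̄`, with `R̄` the integral closure of `R` in `Q`. -/
structure IsFractionalCanonicalIdeal {R : Type u} [CommRing R] [IsLocalRing R]
    {Q : Type u} [CommRing Q] [Algebra R Q] (K : Submodule R Q) : Prop where
  one_le : 1 ≤ K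
  le_integralClosure : K ≤ Subalgebra.toSubmodule (integralClosure R Q)
  isCanonicalModule : IsCanonicalModule R K

/-- `CM(A)` for an `R`-algebra `A`, as a full subcategory of the `R`-modules: those `R`-modules
whose action extends to an action of `A` that makes them MCM over `A`. -/
def CMCat (R : Type u) [CommRing R] (A : Type u) [CommRing A] [Algebra R A] :
    ObjectProperty (ModuleCat.{u} R) :=
  fun M => ∃ _ : Module A M, IsScalarTower R A M ∧ IsMCM A M

/-- `ΩCM(A)` for an `R`-algebra `A`, as a full subcategory of the `R`-modules: those `R`-modules
whose action extends to an action of `A` that makes them first syzygies of MCM `A`-modules. -/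
def OmegaCMCat (R : Type u) [CommRing R] (A : Type u) [CommRing A] [Algebra R A] :
    ObjectProperty (ModuleCat.{u} R) :=
  fun M => ∃ _ : Module A M, IsScalarTower R A M ∧ IsSyzygyOfMCM A M

/-- `ΩCM(R, J)`: the first syzygies `M` of MCM `R`-modules with `tr_R(M) ⊆ J`. -/
def OmegaCMTraceCat (R : Type u) [CommRing R] (J : Ideal R) : ObjectProperty (ModuleCat.{u} R) :=
  fun M => IsSyzygyOfMCM R M ∧ moduleTrace R M ≤ J

end

/-!
Write `A = I : I`. Over a one-dimensional Cohen-Macaulay local ring, and over its finite birational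
extensions, an MCM module is a finite torsion-free module (`isMCM_iff`), and a syzygy of an MCM module
is a submodule of a finite free module with torsion-free cokernel, here called a saturated embedding
(`isSyzygyOfMCM_iff`). All three parts become statements about such embeddings and about fractional
ideals in `Q`.

For a reflexive regular trace ideal, `A = R : I` and `I = R : A`. The second equality says that a linear
form from an `A`-module to `R` has values in `I`, and multiplication by generators of `I` embeds `A` as a
saturated submodule of a free `R`-module; so `ΩCM(A) ⊆ ΩCM(R, I)`. A module that is saturated in `Rⁿ`
and has its coordinates in `I` is closed under the scalars from `A`; so `ΩCM(R, I) ⊆ CM(A)`.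

`ΩCM(A) = ΩCM(R, I)` holds exactly if `I` is invertible over `A`, that is `1 ∈ I (A : I)`. If `I` is
invertible, the coordinates of a saturated embedding in `Iⁿ` can be exchanged for coordinates in `A`
(`omegaCMTraceCat_le_omegaCMCat`). Conversely `I` itself belongs to `ΩCM(R, I)`, and if it is a syzygy
over `A` it is reflexive over `A`; together with `I : I = A` this forces invertibility
(`one_mem_of_div_div_le`). Invertible ideals are stable, and a stable ideal is invertible because some
power `I ^ k` has a principal reduction `x`, so that `I ^ k / x ⊆ A` (`one_mem_of_isStableIdeal`). The
power is needed when the residue field is finite; its reduction is found in the Rees algebra, where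
the bounded number of generators of the powers of `I` gives algebraic relations modulo the maximal
ideal (`exists_pow_eq_span_singleton_mul`).

For the canonical ideal `K`, both `I ⊆ 𝔠` and `I K = I` say that `K ⊆ A`. Type one means that `K / xK`
has a simple socle for a parameter `x`, and it has the length of `R / x`; by counting lengths it is
an injective cogenerator over `R / x`, and forms into `K` detect divisibility in MCM modules
(`IsFractionalCanonicalIdeal.exists_smul_eq`). Therefore fractional ideals are reflexive with respect to
`K`. If `K ⊆ A`, forms from an MCM `A`-module into `K` have values in `K : K = R`, and generators of
the module of these forms give a saturated embedding in a free `R`-module. If conversely the canonical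
module `K : A` of `A` is a syzygy over `R`, then it is reflexive over `R`, which amounts to
`1 ∈ K (A : K)`; since `K` is finite and integral over `R`, its powers stabilize, and
`K ⊆ Kⁿ⁺¹ (A : K)ⁿ = Kⁿ (A : K)ⁿ ⊆ A` (`le_of_one_mem_mul_div`).
-/

/-! ### Maximal Cohen-Macaulay modules over finite algebras over a one-dimensional ring -/

theorem krullDimLE_one_of_isIntegral (R A : Type*) [CommRing R] [CommRing A] [Algebra R A]
    [Algebra.IsIntegral R A] [Ring.KrullDimLE 1 R] : Ring.KrullDimLE 1 A := by
  refine Ring.KrullDimLE.mk₁ fun p hp => ?_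
  rcases Ring.krullDimLE_one_iff.mp ‹_› (p.comap (algebraMap R A)) inferInstance with h | h
  · left
    refine ⟨⟨hp, bot_le⟩, fun q hq hqp => ?_⟩
    have := hq.1
    by_contra hne
    have hlt : q < p := lt_of_le_not_ge hqp hne
    have := Ideal.IsIntegral.comap_lt_comap (R := R) hlt
    exact absurd (h.2 ⟨inferInstance, bot_le⟩ this.le) this.not_ge
  · exact Or.inr (Ideal.IsIntegral.isMaximal_of_isMaximal_comap (R := R) p h)

theorem one_le_moduleDepth_iff {R : Type u} [CommRing R] [IsLocalRing R]
    {M : Type u} [AddCommGroup M] [Module R M] :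
    1 ≤ moduleDepth R M ↔ ∃ r ∈ IsLocalRing.maximalIdeal R, IsSMulRegular M r := by
  constructor
  · intro h
    by_contra! hno
    have : moduleDepth R M ≤ 0 := by
      refine iSup₂_le fun rs hrs => ?_
      cases rs with
      | nil => simp
      | cons r rs =>
        exact absurd ((RingTheory.Sequence.isWeaklyRegular_cons_iff M r rs).mp hrs.1).1
          (hno r (hrs.2 r (by simp)))
    exact absurd (h.trans this) (by simp)
  · rintro ⟨r, hr, hreg⟩
    refine le_iSup₂_of_le [r] ⟨?_, by simpa using hr⟩ (by simp)
    exact (RingTheory.Sequence.isWeaklyRegular_singleton_iff M r).mpr hreg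

/-- A one-dimensional Cohen-Macaulay local ring has a regular element in its maximal ideal. -/
theorem IsCMLocalRing.exists_mem_maximalIdeal {R : Type u} [CommRing R] [IsLocalRing R]
    (hCM : IsCMLocalRing R) (hdim : ringKrullDim R = 1) :
    ∃ c ∈ IsLocalRing.maximalIdeal R, c ∈ nonZeroDivisors R := by
  have h : 1 ≤ moduleDepth R R := by
    have := hCM.depth_eq
    rw [hdim] at this
    exact (by exact_mod_cast this.ge : (1 : ℕ∞) ≤ _)
  obtain ⟨c, hc, hreg⟩ := one_le_moduleDepth_iff.mp h
  refine ⟨c, hc, mem_nonZeroDivisors_iff_right.mpr fun x hx => ?_⟩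
  exact hreg.right_eq_zero_of_smul (by simpa [mul_comm] using hx)

theorem exists_mem_associatedPrime_of_smul_eq_zero {A M : Type*} [CommRing A] [IsNoetherianRing A]
    [AddCommGroup M] [Module A M] {a : A} {x : M} (hx : x ≠ 0) (h : a • x = 0) :
    ∃ (p : Ideal A) (y : M), p.IsPrime ∧ a ∈ p ∧ ∀ b, b ∈ p ↔ b • y = 0 := by
  obtain ⟨p, hp, hle⟩ := exists_le_isAssociatedPrime_of_isNoetherianRing A x hx
  obtain ⟨hp1, y, rfl⟩ := isAssociatedPrime_iff.mp hp
  exact ⟨_, y, hp1, hle (by simpa [Submodule.mem_colon_singleton] using h),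
    fun b => by simp [Submodule.mem_colon_singleton]⟩

theorem isTorsionFree_iff_mem_nonZeroDivisors {R M : Type*} [CommRing R] [AddCommGroup M]
    [Module R M] :
    Module.IsTorsionFree R M ↔ ∀ r ∈ nonZeroDivisors R, ∀ x : M, r • x = 0 → x = 0 := by
  constructor
  · intro h r hr x hx
    exact (h.isSMulRegular (isRegular_iff_mem_nonZeroDivisors.mpr hr)).right_eq_zero_of_smul hx
  · exact fun h => ⟨fun r hr => IsSMulRegular.of_right_eq_zero_of_smul
      (h r (isRegular_iff_mem_nonZeroDivisors.mp hr))⟩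

/-- Over a finite torsion-free algebra `A` over a one-dimensional local ring `R` with a regular
element in its maximal ideal, the MCM modules are the finite modules without `R`-torsion: every
non-minimal prime of `A` lies over the maximal ideal of `R`, and has height one. -/
theorem isMCM_iff {R : Type u} [CommRing R] [IsLocalRing R] [IsNoetherianRing R]
    [Ring.KrullDimLE 1 R] {c : R} (hcm : c ∈ IsLocalRing.maximalIdeal R)
    (hc : c ∈ nonZeroDivisors R) {A : Type u} [CommRing A] [Algebra R A] [Module.Finite R A]
    [Module.IsTorsionFree R A]
    {M : Type u} [AddCommGroup M] [Module A M] [Module R M] [IsScalarTower R A M] :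
    IsMCM A M ↔ Module.Finite A M ∧ Module.IsTorsionFree R M := by
  have hA : ∀ r ∈ nonZeroDivisors R, algebraMap R A r ∈ nonZeroDivisors A := fun r hr =>
    mem_nonZeroDivisors_iff_right.mpr fun x hx =>
      isTorsionFree_iff_mem_nonZeroDivisors.mp ‹Module.IsTorsionFree R A› r hr x
        (by rwa [Algebra.smul_def, mul_comm])
  have : IsNoetherianRing A := IsNoetherianRing.of_finite R A
  have hdimA := krullDimLE_one_of_isIntegral R A
  constructor
  · intro h
    refine ⟨h.finite, isTorsionFree_iff_mem_nonZeroDivisors.mpr fun r hr x hx => ?_⟩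
    rw [← algebraMap_smul A] at hx
    by_contra hx0
    -- A nonzero element killed by `r` yields an associated prime of `M` of positive height.
    obtain ⟨p, y, hp, hrp, hy⟩ := exists_mem_associatedPrime_of_smul_eq_zero hx0 hx
    have hht : 1 ≤ p.height := (Ideal.one_le_height_span_singleton_of_mem_nonZeroDivisors
      (hA r hr)).trans (Ideal.height_mono (by simpa [Ideal.span_le] using hrp))
    have hd := h.dim_le_depth p
    rw [IsLocalization.AtPrime.ringKrullDim_eq_height p] at hd
    have hd1 : 1 ≤ moduleDepth (Localization.AtPrime p) (LocalizedModule p.primeCompl M) :=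
      hht.trans (by exact_mod_cast hd)
    obtain ⟨b, hb, hreg⟩ := one_le_moduleDepth_iff.mp hd1
    have hker : b • LocalizedModule.mk y (1 : p.primeCompl) = 0 := by
      obtain ⟨a, s, rfl⟩ := IsLocalization.exists_mk'_eq p.primeCompl b
      rw [IsLocalization.AtPrime.mk'_mem_maximal_iff (Localization.AtPrime p) p] at hb
      rw [← Localization.mk_eq_mk', LocalizedModule.mk_smul_mk, (hy a).mp hb, LocalizedModule.zero_mk]
    have h0 := hreg.right_eq_zero_of_smul hker
    rw [← LocalizedModule.zero_mk (1 : p.primeCompl), LocalizedModule.mk_eq] at h0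
    obtain ⟨u, hu⟩ := h0
    exact u.2 ((hy u).mpr (by simpa [Submonoid.smul_def] using hu))
  · rintro ⟨hfin, h_tf⟩
    rw [isTorsionFree_iff_mem_nonZeroDivisors] at h_tf
    refine ⟨hfin, fun p hp => ?_⟩
    rw [IsLocalization.AtPrime.ringKrullDim_eq_height p]
    by_cases hmin : p ∈ minimalPrimes A
    · rw [Ideal.height_eq_zero_iff.mpr hmin]
      exact_mod_cast zero_le
    have hmax := (Ring.krullDimLE_one_iff.mp hdimA p hp).resolve_left hmin
    have hht : p.height ≤ 1 := by
      have h1 : ringKrullDim A ≤ 1 := (Order.krullDimLE_iff 1 _).mp hdimA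
      exact_mod_cast (Ideal.height_le_ringKrullDim_of_isPrime (I := p)).trans h1
    suffices 1 ≤ moduleDepth (Localization.AtPrime p) (LocalizedModule p.primeCompl M) from
      by exact_mod_cast hht.trans this
    have hcp : algebraMap R A c ∈ p := by
      have : (p.comap (algebraMap R A)).IsMaximal :=
        Ideal.isMaximal_comap_of_isIntegral_of_isMaximal p
      change c ∈ p.comap (algebraMap R A)
      rwa [IsLocalRing.eq_maximalIdeal this]
    refine one_le_moduleDepth_iff.mpr ⟨algebraMap A _ (algebraMap R A c),
      (IsLocalization.AtPrime.to_map_mem_maximal_iff _ p _).mpr hcp, ?_⟩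
    have hregM : IsSMulRegular M (algebraMap R A c) :=
      IsSMulRegular.of_right_eq_zero_of_smul fun x hx => h_tf c hc x (by simpa using hx)
    exact hregM.of_isLocalizedModule (S := Localization.AtPrime p) p.primeCompl
      (LocalizedModule.mkLinearMap p.primeCompl M)

/-- A map `f : M → N` of modules is a saturated embedding if it is injective and its cokernel has
no torsion with respect to the non-zerodivisors of `R`. It is stated for a bare function so that
one notion serves maps that are linear over `R` or over an `R`-algebra. -/
structure IsSaturatedEmbedding (R : Type*) [CommRing R] {M N : Type*} [AddCommGroup N] [Module R N]
    (f : M → N) : Prop where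
  injective : Function.Injective f
  saturated : ∀ r ∈ nonZeroDivisors R, ∀ n m, r • n = f m → ∃ m', f m' = n

/-- Syzygies of MCM modules are the saturated submodules of finite free modules: the cokernel of an
embedding in a finite free module is MCM exactly if it has no torsion. -/
theorem isSyzygyOfMCM_iff {R : Type u} [CommRing R] [IsLocalRing R] [IsNoetherianRing R]
    [Ring.KrullDimLE 1 R] {c : R} (hcm : c ∈ IsLocalRing.maximalIdeal R)
    (hc : c ∈ nonZeroDivisors R) {A : Type u} [CommRing A] [Algebra R A] [Module.Finite R A]
    [Module.IsTorsionFree R A]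
    {M : Type u} [AddCommGroup M] [Module A M] [Module R M] [IsScalarTower R A M] :
    IsSyzygyOfMCM A M ↔ ∃ (ι : Type) (_ : Finite ι) (f : M →ₗ[A] (ι → A)),
      IsSaturatedEmbedding R f := by
  have : IsNoetherianRing A := IsNoetherianRing.of_finite R A
  constructor
  · rintro ⟨-, F, X, _, _, _, _, f, g, _, _, hX, hf, hfg, -⟩
    let _ := Module.compHom X (algebraMap R A)
    have : IsScalarTower R A X := .of_algebraMap_smul fun r x => rfl
    have hX' := (isTorsionFree_iff_mem_nonZeroDivisors.mp ((isMCM_iff hcm hc).mp hX).2)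
    let b := Module.Free.chooseBasis A F
    let n := Fintype.card (Module.Free.ChooseBasisIndex A F)
    let e : F ≃ₗ[A] (Fin n → A) := (b.reindex (Fintype.equivFin _)).equivFun
    refine ⟨Fin n, inferInstance, e.toLinearMap ∘ₗ f, e.injective.comp hf, fun r hr w m hw => ?_⟩
    have h1 : algebraMap R A r • e.symm w = f m := by
      rw [← map_smul, algebraMap_smul, hw]
      simp
    have h2 : g (e.symm w) = 0 := by
      refine hX' r hr _ ?_
      rw [← algebraMap_smul A, ← map_smul, h1]
      exact hfg.apply_apply_eq_zero m
    obtain ⟨m', hm'⟩ := (hfg _).mp h2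
    exact ⟨m', by simp [hm']⟩
  · rintro ⟨ι, _, f, hf⟩
    refine ⟨Module.Finite.of_injective f hf.injective, ι → A, (ι → A) ⧸ LinearMap.range f,
      inferInstance, inferInstance, inferInstance, inferInstance, f, (LinearMap.range f).mkQ,
      inferInstance, inferInstance, (isMCM_iff hcm hc).mpr ⟨inferInstance, ?_⟩, hf.injective,
      LinearMap.exact_map_mkQ_range f, Submodule.mkQ_surjective _⟩
    refine isTorsionFree_iff_mem_nonZeroDivisors.mpr fun r hr x => ?_
    obtain ⟨w, rfl⟩ := Submodule.mkQ_surjective _ x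
    intro hw
    rw [← algebraMap_smul A, ← map_smul, algebraMap_smul, Submodule.mkQ_apply,
      Submodule.Quotient.mk_eq_zero] at hw
    obtain ⟨m, hm⟩ := hw
    rw [Submodule.mkQ_apply, Submodule.Quotient.mk_eq_zero]
    exact hf.saturated r hr w m hm.symm

/-! ### The endomorphism ring `I : I` of a reflexive trace ideal -/

section

variable {R : Type u} [CommRing R] {Q : Type u} [CommRing Q] [Algebra R Q]

theorem exists_linearMap_algebraMap_eq [FaithfulSMul R Q] {M : Type*} [AddCommGroup M] [Module R M]
    (g : M →ₗ[R] Q) (h : ∀ m, ∃ r, algebraMap R Q r = g m) :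
    ∃ f : M →ₗ[R] R, ∀ m, algebraMap R Q (f m) = g m := by
  have hinj : Function.Injective (Algebra.linearMap R Q) := FaithfulSMul.algebraMap_injective R Q
  let e := LinearEquiv.ofInjective (Algebra.linearMap R Q) hinj
  refine ⟨e.symm.toLinearMap ∘ₗ g.codRestrict (LinearMap.range (Algebra.linearMap R Q)) h,
    fun m => ?_⟩
  exact congrArg Subtype.val (e.apply_symm_apply
    (g.codRestrict (LinearMap.range (Algebra.linearMap R Q)) h m))

theorem mem_colonAlgebra_iff {I : Ideal R} {q : Q} :
    q ∈ colonAlgebra Q I ↔ ∀ i ∈ I, ∃ j ∈ I, algebraMap R Q j = q * algebraMap R Q i := by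
  change q ∈ (IsLocalization.coeSubmodule Q I / IsLocalization.coeSubmodule Q I) ↔ _
  rw [Submodule.mem_div_iff_forall_mul_mem]
  simp

theorem apply_mem_moduleTrace {M : Type u} [AddCommGroup M] [Module R M] (f : M →ₗ[R] R) (m : M) :
    f m ∈ moduleTrace R M := ⟨f ⊗ₜ[R] m, by simp⟩

theorem moduleTrace_le_iff {M : Type u} [AddCommGroup M] [Module R M] {J : Ideal R} :
    moduleTrace R M ≤ J ↔ ∀ (f : M →ₗ[R] R) (m : M), f m ∈ J := by
  refine ⟨fun h f m => h (apply_mem_moduleTrace f m), fun h => ?_⟩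
  rintro _ ⟨t, rfl⟩
  induction t with
  | zero => simp
  | tmul f m => simpa using h f m
  | add a b ha hb => simpa using J.add_mem ha hb

/-- The trace ideal is stable under every linear form it carries; for a trace ideal `I` this reads
`R : I = I : I`. -/
theorem IsTraceIdeal.mem_colonAlgebra [FaithfulSMul R Q] {I : Ideal R} (htr : IsTraceIdeal I)
    {q : Q} (h : ∀ i ∈ I, ∃ r, algebraMap R Q r = q * algebraMap R Q i) :
    q ∈ colonAlgebra Q I := by
  obtain ⟨M, _, _, rfl⟩ := htr
  obtain ⟨ψ, hψ⟩ := exists_linearMap_algebraMap_eq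
    ((LinearMap.mulLeft R q) ∘ₗ (Algebra.linearMap R Q) ∘ₗ (moduleTrace R M).subtype)
    (fun i => h i i.2)
  suffices hs : ∀ i (hi : i ∈ moduleTrace R M), ψ ⟨i, hi⟩ ∈ moduleTrace R M from
    mem_colonAlgebra_iff.mpr fun i hi => ⟨_, hs i hi, hψ ⟨i, hi⟩⟩
  rintro _ ⟨t, rfl⟩
  change (ψ ∘ₗ (contractLeft R M).rangeRestrict) t ∈ _
  induction t with
  | zero => simp
  | tmul f m =>
    convert! apply_mem_moduleTrace (ψ ∘ₗ f.codRestrict _ (apply_mem_moduleTrace f)) m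
  | add a b ha hb => simpa only [map_add] using (moduleTrace R M).add_mem ha hb

variable [IsFractionRing R Q]

theorem isUnit_algebraMap_of_mem_nonZeroDivisors (Q : Type*) [CommRing Q] [Algebra R Q]
    [IsFractionRing R Q] {r : R} (hr : r ∈ nonZeroDivisors R) :
    IsUnit (algebraMap R Q r) := IsLocalization.map_units Q (⟨r, hr⟩ : nonZeroDivisors R)

theorem exists_smul_eq_algebraMap (q : Q) :
    ∃ r ∈ nonZeroDivisors R, ∃ b, r • q = algebraMap R Q b := by
  obtain ⟨⟨r, hr⟩, b, hb⟩ := IsLocalization.exists_integer_multiple (nonZeroDivisors R) q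
  exact ⟨r, hr, b, hb.symm⟩

instance isTorsionFree_fractionRing (R Q : Type*) [CommRing R] [CommRing Q] [Algebra R Q]
    [IsFractionRing R Q] : Module.IsTorsionFree R Q :=
  isTorsionFree_iff_mem_nonZeroDivisors.mpr fun r hr x hx => by
    rw [Algebra.smul_def] at hx
    exact (isUnit_algebraMap_of_mem_nonZeroDivisors Q hr).mul_right_eq_zero.mp hx

theorem smul_right_cancel_of_mem_nonZeroDivisors {M : Type*} [AddCommGroup M]
    [Module R M] [h : Module.IsTorsionFree R M] {r : R} (hr : r ∈ nonZeroDivisors R) {x y : M}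
    (hxy : r • x = r • y) : x = y :=
  h.isSMulRegular (isRegular_iff_mem_nonZeroDivisors.mpr hr) hxy

/-- Between modules over a birational extension `S` of `R`, an `R`-linear map into a torsion-free
module is `S`-linear: clear the denominator of the scalar. -/
theorem map_smul_of_isTorsionFree {S : Subalgebra R Q} {M N : Type*} [AddCommGroup M]
    [AddCommGroup N] [Module R M] [Module R N] [Module S M] [Module S N] [IsScalarTower R S M]
    [IsScalarTower R S N] [Module.IsTorsionFree R N] (f : M →ₗ[R] N) (a : S) (x : M) :
    f (a • x) = a • f x := by
  obtain ⟨r, hr, b, hb⟩ := exists_smul_eq_algebraMap (R := R) (a : Q)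
  have hab : r • a = algebraMap R S b := Subtype.ext hb
  apply smul_right_cancel_of_mem_nonZeroDivisors hr
  rw [← map_smul, ← smul_assoc, ← smul_assoc, hab, algebraMap_smul, algebraMap_smul, map_smul]

omit [IsFractionRing R Q] in
theorem fg_of_isUnit_mul_mem [IsNoetherianRing R] {X Y : Submodule R Q} (hY : Y.FG) {u : Q}
    (hu : IsUnit u) (h : ∀ x ∈ X, u * x ∈ Y) : X.FG := by
  have : Module.Finite R Y := Module.Finite.iff_fg.mpr hY
  refine Module.Finite.iff_fg.mp (Module.Finite.of_injective
    ((LinearMap.mulLeft R u).restrict h) fun x y hxy => ?_)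
  exact Subtype.ext (hu.mul_left_cancel (congrArg Subtype.val hxy))

theorem module_finite_colonAlgebra [IsNoetherianRing R] {I : Ideal R} (hreg : IsRegularIdeal I) :
    Module.Finite R (colonAlgebra Q I) := by
  obtain ⟨a, ha, ha'⟩ := hreg
  have hfg : (IsLocalization.coeSubmodule Q I).FG :=
    Submodule.FG.map _ (IsNoetherian.noetherian I)
  refine Module.Finite.iff_fg.mpr (fg_of_isUnit_mul_mem
    (X := Subalgebra.toSubmodule (colonAlgebra Q I)) hfg
    (isUnit_algebraMap_of_mem_nonZeroDivisors Q ha') fun x hx => ?_)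
  obtain ⟨j, hj, hjx⟩ := mem_colonAlgebra_iff.mp hx a ha
  exact ⟨j, hj, hjx.trans (mul_comm _ _)⟩

/-- Every linear form on a regular ideal is multiplication by a fraction. -/
theorem exists_eq_mul_algebraMap {I : Ideal R} (hreg : IsRegularIdeal I) (f : I →ₗ[R] Q) :
    ∃ q : Q, ∀ i : I, f i = q * algebraMap R Q i := by
  obtain ⟨a, ha, ha'⟩ := hreg
  obtain ⟨u, hu⟩ := isUnit_algebraMap_of_mem_nonZeroDivisors Q ha'
  refine ⟨↑u⁻¹ * f ⟨a, ha⟩, fun i => ?_⟩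
  rw [mul_assoc, Units.eq_inv_mul_iff_mul_eq, hu, mul_comm (f _), ← Algebra.smul_def,
    ← Algebra.smul_def, ← map_smul, ← map_smul]
  congr 1
  exact Subtype.ext (mul_comm _ _)

/-- A reflexive regular trace ideal is the conductor of its endomorphism ring: `I = R : (I : I)`. -/
theorem exists_mem_of_forall_colonAlgebra {I : Ideal R} (hreg : IsRegularIdeal I)
    (hrefl : Module.IsReflexive R I) (htr : IsTraceIdeal I) {q : Q}
    (h : ∀ a ∈ colonAlgebra Q I, ∃ r, algebraMap R Q r = q * a) :
    ∃ i ∈ I, algebraMap R Q i = q := by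
  obtain ⟨a, ha, ha'⟩ := id hreg
  obtain ⟨u, hu⟩ := isUnit_algebraMap_of_mem_nonZeroDivisors Q ha'
  -- `φ ↦ q * (φ a / a)` is the element of the bidual of `I` given by multiplication by `q`.
  let g : Module.Dual R I →ₗ[R] Q :=
    LinearMap.mulLeft R (q * ↑u⁻¹) ∘ₗ Algebra.linearMap R Q ∘ₗ Module.Dual.eval R I ⟨a, ha⟩
  have hg : ∀ (φ : Module.Dual R I) (p : Q),
      (∀ i : I, algebraMap R Q (φ i) = p * algebraMap R Q i) → g φ = q * p := by
    intro φ p hp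
    simp [g, hp, ← hu, mul_assoc, mul_comm]
  obtain ⟨G, hG⟩ := exists_linearMap_algebraMap_eq g (fun φ => by
    obtain ⟨p, hp⟩ := exists_eq_mul_algebraMap (Q := Q) hreg (Algebra.linearMap R Q ∘ₗ φ)
    rw [hg φ p hp]
    exact h p (htr.mem_colonAlgebra fun i hi => ⟨_, hp ⟨i, hi⟩⟩))
  obtain ⟨i, hi⟩ := hrefl.bijective_dual_eval'.surjective G
  refine ⟨i, i.2, ?_⟩
  have h1 := hg I.subtype 1 (fun i => by simp)
  rw [← hG, ← hi] at h1
  simpa using h1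

/-! ### Syzygies over `R` with trace in `I` -/

omit [IsFractionRing R Q] in
theorem IsSaturatedEmbedding.pi_comp {M N P ι κ : Type*} [AddCommGroup M] [Module R M]
    [AddCommGroup N] [Module R N] [AddCommGroup P] [Module R P] {f : M →ₗ[R] (ι → N)}
    (hf : IsSaturatedEmbedding R f) {g : N →ₗ[R] (κ → P)} (hg : IsSaturatedEmbedding R g) :
    IsSaturatedEmbedding R (fun m (p : ι × κ) => g (f m p.1) p.2) := by
  refine ⟨fun m m' h => hf.injective (funext fun i => hg.injective (funext fun k =>
    congrFun h (i, k))), fun r hr w m hw => ?_⟩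
  choose n hn using fun i => hg.saturated r hr (fun k => w (i, k)) (f m i)
    (funext fun k => congrFun hw (i, k))
  have hrn : r • n = f m := funext fun i => hg.injective (by
    rw [Pi.smul_apply, map_smul, hn]
    exact funext fun k => congrFun hw (i, k))
  obtain ⟨m', hm'⟩ := hf.saturated r hr n m hrn
  exact ⟨m', funext fun p => by rw [hm', hn]⟩

omit [IsFractionRing R Q] in
theorem mem_one_div_iff {Y : Submodule R Q} {q : Q} :
    q ∈ 1 / Y ↔ ∀ y ∈ Y, ∃ r, algebraMap R Q r = q * y := by
  simp [Submodule.mem_div_iff_forall_mul_mem, Submodule.mem_one]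

/-- The dual `R : Y` of a finite regular fractional ideal is a syzygy: multiplication by generators
of `Y` embeds it in a free module with torsion-free cokernel. -/
theorem exists_isSaturatedEmbedding_one_div {X Y : Submodule R Q} (hY : Y.FG) {u : Q} (hu : IsUnit u)
    (huY : u ∈ Y) (hX : X = 1 / Y) :
    ∃ (κ : Type) (_ : Finite κ) (g : X →ₗ[R] (κ → R)), IsSaturatedEmbedding R g := by
  subst hX
  obtain ⟨n, s, rfl⟩ := Submodule.fg_iff_exists_fin_generating_family.mp hY
  have hex : ∀ j, ∃ f : (1 / Submodule.span R (Set.range s) : Submodule R Q) →ₗ[R] R,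
      ∀ a, algebraMap R Q (f a) = a * s j := fun j =>
    exists_linearMap_algebraMap_eq (LinearMap.mulRight R (s j) ∘ₗ Submodule.subtype _)
      (fun a => mem_one_div_iff.mp a.2 _ (Submodule.subset_span ⟨j, rfl⟩))
  choose f hf using hex
  refine ⟨Fin n, inferInstance, LinearMap.pi f, ?_, ?_⟩
  · rw [injective_iff_map_eq_zero]
    intro a ha
    have hle : Submodule.span R (Set.range s) ≤ LinearMap.ker (LinearMap.mulLeft R (a : Q)) := by
      rw [Submodule.span_le]
      rintro _ ⟨j, rfl⟩
      simp [← hf, show f j a = 0 from congrFun ha j]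
    exact Subtype.ext (hu.mul_left_eq_zero.mp (hle huY))
  · intro r hr w a hw
    obtain ⟨v, hv⟩ := isUnit_algebraMap_of_mem_nonZeroDivisors Q hr
    have hq : ∀ j, algebraMap R Q (w j) = ↑v⁻¹ * (a : Q) * s j := by
      intro j
      rw [mul_assoc, Units.eq_inv_mul_iff_mul_eq, ← hf, hv, ← map_mul]
      exact congrArg _ (congrFun hw j)
    have hmem : ↑v⁻¹ * (a : Q) ∈ 1 / Submodule.span R (Set.range s) := by
      have hle : Submodule.span R (Set.range s) ≤
          Submodule.comap (LinearMap.mulLeft R (↑v⁻¹ * (a : Q))) 1 := by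
        rw [Submodule.span_le]
        rintro _ ⟨j, rfl⟩
        exact Submodule.mem_one.mpr ⟨_, hq j⟩
      exact Submodule.mem_div_iff_forall_mul_mem.mpr fun y hy => hle hy
    refine ⟨⟨_, hmem⟩, funext fun j => FaithfulSMul.algebraMap_injective R Q ?_⟩
    rw [hq]
    exact hf j _

theorem colonAlgebra_eq_one_div {I : Ideal R} (htr : IsTraceIdeal I) :
    Subalgebra.toSubmodule (colonAlgebra Q I) = 1 / IsLocalization.coeSubmodule Q I := by
  ext q
  rw [mem_one_div_iff]
  constructor
  · rintro h _ ⟨i, hi, rfl⟩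
    obtain ⟨j, -, hj⟩ := mem_colonAlgebra_iff.mp h i hi
    exact ⟨j, hj⟩
  · exact fun h => htr.mem_colonAlgebra fun i hi => h _ ⟨i, hi, rfl⟩

theorem coeSubmodule_eq_one_div_colonAlgebra {I : Ideal R} (hreg : IsRegularIdeal I)
    (hrefl : Module.IsReflexive R I) (htr : IsTraceIdeal I) :
    IsLocalization.coeSubmodule Q I = 1 / Subalgebra.toSubmodule (colonAlgebra Q I) := by
  ext q
  rw [mem_one_div_iff]
  constructor
  · rintro ⟨i, hi, rfl⟩ a ha
    obtain ⟨j, -, hj⟩ := mem_colonAlgebra_iff.mp ha i hi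
    exact ⟨j, hj.trans (mul_comm _ _)⟩
  · exact fun h => exists_mem_of_forall_colonAlgebra hreg hrefl htr h

theorem IsRegularIdeal.exists_isUnit {I : Ideal R} (hreg : IsRegularIdeal I) :
    ∃ u ∈ IsLocalization.coeSubmodule Q I, IsUnit u := by
  obtain ⟨a, ha, ha'⟩ := hreg
  exact ⟨_, ⟨a, ha, rfl⟩, isUnit_algebraMap_of_mem_nonZeroDivisors Q ha'⟩

omit [IsFractionRing R Q] in
theorem fg_coeSubmodule [IsNoetherianRing R] (I : Ideal R) :
    (IsLocalization.coeSubmodule Q I).FG :=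
  Submodule.FG.map _ (IsNoetherian.noetherian I)

/-- An `R`-linear form on a module over `I : I` takes its values in the conductor
`R : (I : I) = I`. -/
theorem apply_mem_of_isReflexive {I : Ideal R} (hreg : IsRegularIdeal I)
    (hrefl : Module.IsReflexive R I) (htr : IsTraceIdeal I) {M : Type*} [AddCommGroup M]
    [Module R M] [Module (colonAlgebra Q I) M] [IsScalarTower R (colonAlgebra Q I) M]
    (f : M →ₗ[R] R) (m : M) : f m ∈ I := by
  obtain ⟨i, hi, him⟩ := exists_mem_of_forall_colonAlgebra hreg hrefl htr
    (q := algebraMap R Q (f m)) (fun a ha => by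
      have := map_smul_of_isTorsionFree (S := colonAlgebra Q I)
        (Algebra.linearMap R Q ∘ₗ f) ⟨a, ha⟩ m
      exact ⟨f ((⟨a, ha⟩ : colonAlgebra Q I) • m), this.trans (mul_comm _ _)⟩)
  rwa [FaithfulSMul.algebraMap_injective R Q him] at hi

/-- A module that is saturated in a free module and has all its coordinates in `I` is a module over
`I : I`: it is the intersection of the free module with its span over the fractions. -/
theorem exists_module_colonAlgebra {I : Ideal R} {M ι : Type*} [AddCommGroup M] [Module R M]
    {f : M →ₗ[R] (ι → R)} (hf : IsSaturatedEmbedding R f) (h : ∀ m j, f m j ∈ I) :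
    ∃ _ : Module (colonAlgebra Q I) M, IsScalarTower R (colonAlgebra Q I) M := by
  have hex : ∀ (a : colonAlgebra Q I) (m : M), ∃ m', ∀ j,
      algebraMap R Q (f m' j) = a * algebraMap R Q (f m j) := by
    intro a m
    choose w hw hw' using fun j => mem_colonAlgebra_iff.mp a.2 _ (h m j)
    obtain ⟨r, hr, b, hb⟩ := exists_smul_eq_algebraMap (R := R) (a : Q)
    obtain ⟨m', hm'⟩ := hf.saturated r hr w (b • m) (funext fun j =>
      FaithfulSMul.algebraMap_injective R Q (by
        rw [Pi.smul_apply, LinearMap.map_smul, Pi.smul_apply, smul_eq_mul, smul_eq_mul, map_mul,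
          map_mul, hw', ← hb, Algebra.smul_def, mul_assoc]))
    exact ⟨m', fun j => by rw [hm', hw']⟩
  choose s hs using hex
  let F : M →ₗ[R] (ι → Q) := LinearMap.pi fun j => Algebra.linearMap R Q ∘ₗ LinearMap.proj j ∘ₗ f
  have hF : Function.Injective F := fun x y hxy => hf.injective (funext fun j =>
    FaithfulSMul.algebraMap_injective R Q (congrFun hxy j))
  let _ : SMul (colonAlgebra Q I) M := ⟨s⟩
  have hsF : ∀ (a : colonAlgebra Q I) (m : M), F (a • m) = a • F m := fun a m => funext (hs a m)
  refine ⟨hF.module _ F.toAddMonoidHom hsF, ⟨fun r a m => hF ?_⟩⟩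
  exact (hsF (r • a) m).trans ((smul_assoc r a (F m)).trans
    ((congrArg _ (hsF a m).symm).trans (F.map_smul r (a • m)).symm))

section

variable [IsLocalRing R] [IsNoetherianRing R] [Ring.KrullDimLE 1 R] {c : R} {I : Ideal R}

theorem omegaCMCat_le_omegaCMTraceCat (hcm : c ∈ IsLocalRing.maximalIdeal R)
    (hc : c ∈ nonZeroDivisors R) (hreg : IsRegularIdeal I) (hrefl : Module.IsReflexive R I)
    (htr : IsTraceIdeal I) :
    OmegaCMCat R (colonAlgebra Q I) ≤ OmegaCMTraceCat R I := by
  rintro M ⟨_, _, hM⟩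
  have := module_finite_colonAlgebra (Q := Q) hreg
  obtain ⟨ι, _, f, hf⟩ := (isSyzygyOfMCM_iff hcm hc).mp hM
  obtain ⟨u, huI, hu⟩ := hreg.exists_isUnit (Q := Q)
  obtain ⟨κ, _, g, hg⟩ := exists_isSaturatedEmbedding_one_div (fg_coeSubmodule I) hu huI
    (colonAlgebra_eq_one_div (Q := Q) htr)
  have hfg := IsSaturatedEmbedding.pi_comp (f := f.restrictScalars R) hf hg
  refine ⟨(isSyzygyOfMCM_iff hcm hc).mpr ⟨ι × κ, inferInstance, LinearMap.pi fun p =>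
    LinearMap.proj (R := R) (φ := fun _ : κ => R) p.2 ∘ₗ g ∘ₗ
      LinearMap.proj (R := R) (φ := fun _ : ι => colonAlgebra Q I) p.1 ∘ₗ f.restrictScalars R, hfg⟩,
    moduleTrace_le_iff.mpr fun φ m => ?_⟩
  exact apply_mem_of_isReflexive (Q := Q) hreg hrefl htr φ m

theorem omegaCMTraceCat_le_cmCat (hcm : c ∈ IsLocalRing.maximalIdeal R)
    (hc : c ∈ nonZeroDivisors R) (hreg : IsRegularIdeal I) :
    OmegaCMTraceCat R I ≤ CMCat R (colonAlgebra Q I) := by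
  rintro M ⟨hM, hMI⟩
  have := module_finite_colonAlgebra (Q := Q) hreg
  obtain ⟨ι, _, f, hf⟩ := (isSyzygyOfMCM_iff hcm hc).mp hM
  obtain ⟨i1, i2⟩ := exists_module_colonAlgebra (Q := Q) hf fun m j =>
    moduleTrace_le_iff.mp hMI (LinearMap.proj j ∘ₗ f) m
  have := hM.1
  refine ⟨i1, i2, (isMCM_iff hcm hc).mpr
    ⟨Module.Finite.of_restrictScalars_finite R (colonAlgebra Q I) M, ?_⟩⟩
  refine isTorsionFree_iff_mem_nonZeroDivisors.mpr fun r hr x hx => hf.injective ?_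
  apply smul_right_cancel_of_mem_nonZeroDivisors hr
  rw [← map_smul, hx, map_zero, smul_zero]

end

end

/-! ### Lengths modulo a regular element -/

section

variable {R : Type*} [CommRing R]

theorem isArtinianRing_quotient_span_singleton [IsNoetherianRing R] [Ring.KrullDimLE 1 R] {c : R}
    (hc : c ∈ nonZeroDivisors R) : IsArtinianRing (R ⧸ Ideal.span {c}) := by
  rw [isArtinianRing_iff_isNoetherianRing_krullDimLE_zero]
  refine ⟨inferInstance, .mk₀ fun p hp => ?_⟩
  have hcp : c ∈ p.comap (Ideal.Quotient.mk (Ideal.span {c})) := by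
    rw [Ideal.mem_comap, Ideal.Quotient.eq_zero_iff_mem.mpr (Ideal.mem_span_singleton_self c)]
    exact p.zero_mem
  rcases Ring.krullDimLE_one_iff.mp ‹_› (p.comap (Ideal.Quotient.mk (Ideal.span {c})))
    inferInstance with h | h
  · exact absurd hc (notMem_nonZeroDivisors_of_mem_mem_minimalPrimes hcp h)
  · have hmap := Ideal.map_comap_of_surjective _ Ideal.Quotient.mk_surjective p
    rw [← hmap]
    refine (Ideal.map_eq_top_or_isMaximal_of_surjective _ Ideal.Quotient.mk_surjective
      h).resolve_left fun htop => hp.ne_top ?_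
    rw [← hmap, htop]

theorem length_ne_top_of_smul_eq_zero [IsNoetherianRing R] [Ring.KrullDimLE 1 R] {c : R}
    (hc : c ∈ nonZeroDivisors R) {M : Type*} [AddCommGroup M] [Module R M] [Module.Finite R M]
    (h : ∀ x : M, c • x = 0) : Module.length R M ≠ ⊤ := by
  have htors : Module.IsTorsionBySet R M (Ideal.span {c}) := by
    rw [Module.isTorsionBySet_span_singleton_iff]
    exact h
  let _ := htors.module
  have : IsScalarTower R (R ⧸ Ideal.span {c}) M := htors.isScalarTower
  have : Module.Finite (R ⧸ Ideal.span {c}) M := .of_restrictScalars_finite R _ _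
  have := isArtinianRing_quotient_span_singleton hc
  rw [Module.length_eq_of_surjective (R := R ⧸ Ideal.span {c}) Ideal.Quotient.mk_surjective]
  exact Module.length_ne_top

/-- The length of `M / cM` does not change on passing to a submodule of finite colength: both
`M / N` and its image `cM / cN` complete `M / cN`. -/
theorem length_quotient_range_lsmul_eq {M N : Type*} [AddCommGroup M] [Module R M]
    [AddCommGroup N] [Module R N] {c : R} (hcM : ∀ x : M, c • x = 0 → x = 0) (i : N →ₗ[R] M)
    (hi : Function.Injective i) (hlen : Module.length R (M ⧸ LinearMap.range i) ≠ ⊤) :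
    Module.length R (N ⧸ LinearMap.range (LinearMap.lsmul R N c)) =
      Module.length R (M ⧸ LinearMap.range (LinearMap.lsmul R M c)) := by
  let P : Submodule R M := LinearMap.range (c • i)
  have h1 : LinearMap.range (LinearMap.lsmul R N c) ≤ P.comap i := by
    rintro _ ⟨x, rfl⟩
    exact ⟨x, by simp⟩
  have h2 : LinearMap.range i ≤ P.comap (LinearMap.lsmul R M c) := by
    rintro _ ⟨x, rfl⟩
    exact ⟨x, by simp⟩
  have h3 : P ≤ LinearMap.range i := by
    rintro _ ⟨x, rfl⟩
    exact ⟨c • x, by simp⟩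
  have h4 : P ≤ LinearMap.range (LinearMap.lsmul R M c) := by
    rintro _ ⟨x, rfl⟩
    exact ⟨i x, by simp⟩
  have e1 := Module.length_eq_add_of_exact (Submodule.mapQ _ P i h1) (Submodule.factor h3) (by
      rw [injective_iff_map_eq_zero]
      intro x
      obtain ⟨x, rfl⟩ := Submodule.mkQ_surjective _ x
      intro hx
      obtain ⟨y, hy⟩ := (Submodule.Quotient.mk_eq_zero P).mp hx
      exact (Submodule.Quotient.mk_eq_zero _).mpr ⟨y, hi (by simpa using hy)⟩)
    (Submodule.factor_surjective h3) (by
      intro x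
      obtain ⟨x, rfl⟩ := Submodule.mkQ_surjective _ x
      constructor
      · intro hx
        obtain ⟨y, hy⟩ := (Submodule.Quotient.mk_eq_zero _).mp hx
        exact ⟨Submodule.mkQ _ y, congrArg (Submodule.mkQ P) hy⟩
      · rintro ⟨y, hy⟩
        obtain ⟨y, rfl⟩ := Submodule.mkQ_surjective _ y
        rw [← hy]
        exact (Submodule.Quotient.mk_eq_zero _).mpr ⟨y, rfl⟩)
  have e2 := Module.length_eq_add_of_exact (Submodule.mapQ _ P (LinearMap.lsmul R M c) h2)
    (Submodule.factor h4) (by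
      rw [injective_iff_map_eq_zero]
      intro x
      obtain ⟨x, rfl⟩ := Submodule.mkQ_surjective _ x
      intro hx
      obtain ⟨y, hy⟩ := (Submodule.Quotient.mk_eq_zero P).mp hx
      refine (Submodule.Quotient.mk_eq_zero _).mpr ⟨y, ?_⟩
      rw [← sub_eq_zero]
      refine hcM _ ?_
      rw [smul_sub, sub_eq_zero]
      exact hy)
    (Submodule.factor_surjective h4) (by
      intro x
      obtain ⟨x, rfl⟩ := Submodule.mkQ_surjective _ x
      constructor
      · intro hx
        obtain ⟨y, hy⟩ := (Submodule.Quotient.mk_eq_zero _).mp hx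
        exact ⟨Submodule.mkQ _ y, congrArg (Submodule.mkQ P) hy⟩
      · rintro ⟨y, hy⟩
        obtain ⟨y, rfl⟩ := Submodule.mkQ_surjective _ y
        rw [← hy]
        exact (Submodule.Quotient.mk_eq_zero _).mpr ⟨y, rfl⟩)
  rw [e2, add_comm] at e1
  exact (ENat.add_left_injective_of_ne_top hlen e1).symm

end

/-! ### Binary forms and radicals -/

/-- A relation `∑ cᵢ xⁱ yⁿ⁻ⁱ ∈ 𝔞` of degree `n` that is not trivial modulo `𝔪` makes `x` and `y`
integral over a single form `z` in `x` and `y`, up to radical. After removing the powers of `x` and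
`y` that divide it modulo `𝔪`, the relation is a form `q` of degree `d` in which `x ^ d` and `y ^ d`
have unit coefficients, and `z = (xy)^(d+1) + (q (x + y))^2` has no common zero with `xyq`. -/
theorem exists_mem_radical_of_sum_mem {R F : Type*} [CommRing R] [IsLocalRing R] [CommRing F]
    [Algebra R F] {𝔞 : Ideal F} (h𝔞 : (IsLocalRing.maximalIdeal R).map (algebraMap R F) ≤ 𝔞)
    {x y : F} {n : ℕ} {c : ℕ → R} (hc : ∃ i ≤ n, c i ∉ IsLocalRing.maximalIdeal R)
    (hrel : ∑ i ∈ Finset.range (n + 1), c i • (x ^ i * y ^ (n - i)) ∈ 𝔞) :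
    ∃ (d : ℕ) (c' : ℕ → R), ∀ z, z = (x * y) ^ (d + 1) +
      ((∑ j ∈ Finset.range (d + 1), c' j • (x ^ j * y ^ (d - j))) * (x + y)) ^ 2 →
      x ∈ (𝔞 ⊔ Ideal.span {z}).radical ∧ y ∈ (𝔞 ⊔ Ideal.span {z}).radical := by
  classical
  -- `a` and `b` are the least and the largest exponent of `x` with a unit coefficient.
  let s := (Finset.range (n + 1)).filter fun i => c i ∉ IsLocalRing.maximalIdeal R
  have hs : s.Nonempty := by
    obtain ⟨i, hi, hi'⟩ := hc
    exact ⟨i, Finset.mem_filter.mpr ⟨Finset.mem_range.mpr (by omega), hi'⟩⟩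
  obtain ⟨a, ha, hmin⟩ := s.exists_min_image id hs
  obtain ⟨b, hb, hmax⟩ := s.exists_max_image id hs
  have hab : a ≤ b := hmin b hb
  have hbn : b ≤ n := by
    have := (Finset.mem_filter.mp hb).1
    simp at this; omega
  have hua : IsUnit (algebraMap R F (c a)) := RingHom.isUnit_map _ (by
    simpa using (Finset.mem_filter.mp ha).2)
  have hub : IsUnit (algebraMap R F (c b)) := RingHom.isUnit_map _ (by
    simpa using (Finset.mem_filter.mp hb).2)
  refine ⟨b - a, fun j => c (a + j), fun z hz => ?_⟩
  set q := ∑ j ∈ Finset.range (b - a + 1), c (a + j) • (x ^ j * y ^ (b - a - j)) with hq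
  -- Every prime that contains `𝔞` and `z` contains `x` and `y`.
  have key : ∀ P : Ideal F, P.IsPrime → 𝔞 ≤ P → z ∈ P → x ∈ P ∧ y ∈ P := by
    intro P hP h𝔞P hzP
    have hmain : x ^ a * y ^ (n - b) * q ∈ P := by
      have hsub : Finset.Ico a (b + 1) ⊆ Finset.range (n + 1) := by
        intro i hi
        simp only [Finset.mem_Ico, Finset.mem_range] at *
        omega
      have h1 := h𝔞P hrel
      rw [← Finset.sum_sdiff hsub] at h1
      have h2 : ∑ i ∈ Finset.range (n + 1) \ Finset.Ico a (b + 1),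
          c i • (x ^ i * y ^ (n - i)) ∈ P := by
        refine P.sum_mem fun i hi => ?_
        have him : c i ∈ IsLocalRing.maximalIdeal R := by
          by_contra hi'
          simp only [Finset.mem_sdiff, Finset.mem_Ico, Finset.mem_range] at hi
          have his : i ∈ s := by simp only [s, Finset.mem_filter, Finset.mem_range]; exact ⟨hi.1, hi'⟩
          have := hmin i his
          have := hmax i his
          simp only [id] at *
          omega
        rw [Algebra.smul_def]
        exact P.mul_mem_right _ (h𝔞P (h𝔞 (Ideal.mem_map_of_mem _ him)))
      have h3 := (P.add_mem_iff_right h2).mp h1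
      rw [Finset.sum_Ico_eq_sum_range] at h3
      convert h3 using 1
      rw [hq, Finset.mul_sum, show b + 1 - a = b - a + 1 by omega]
      refine Finset.sum_congr rfl fun j hj => ?_
      have : n - (a + j) = (n - b) + (b - a - j) := by
        simp only [Finset.mem_range] at hj
        omega
      rw [this, pow_add, pow_add, mul_smul_comm]
      congr 1
      ring
    have hxq : x ∈ P → q ∈ P → y ∈ P := by
      intro hx hqP
      rw [hq, Finset.sum_range_succ'] at hqP
      have h1 := (P.add_mem_iff_right (P.sum_mem fun j _ => by
        rw [Algebra.smul_def, pow_succ]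
        exact P.mul_mem_left _ (P.mul_mem_right _ (P.mul_mem_left _ hx)))).mp hqP
      rw [add_zero, Algebra.smul_def, Ideal.unit_mul_mem_iff_mem P hua] at h1
      exact hP.mem_of_pow_mem _ (by simpa using h1)
    have hyq : y ∈ P → q ∈ P → x ∈ P := by
      intro hy hqP
      rw [hq, Finset.sum_range_succ] at hqP
      have h1 := (P.add_mem_iff_right (P.sum_mem fun j hj => by
        rw [Finset.mem_range] at hj
        rw [Algebra.smul_def, show b - a - j = (b - a - j - 1) + 1 by omega, pow_succ]
        exact P.mul_mem_left _ (P.mul_mem_left _ (P.mul_mem_left _ hy)))).mp hqP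
      rw [show a + (b - a) = b by omega, Algebra.smul_def,
        Ideal.unit_mul_mem_iff_mem P hub] at h1
      exact hP.mem_of_pow_mem _ (by simpa using h1)
    have hx : x ∈ P → y ∈ P := by
      intro hx
      rw [hz] at hzP
      have h1 := hP.mem_of_pow_mem _ ((P.add_mem_iff_right
        (P.pow_mem_of_mem (P.mul_mem_right _ hx) _ (Nat.succ_pos _))).mp hzP)
      rcases hP.mem_or_mem h1 with h | h
      · exact hxq hx h
      · exact (P.add_mem_iff_right hx).mp h
    have hy : y ∈ P → x ∈ P := by
      intro hy
      rw [hz] at hzP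
      have h1 := hP.mem_of_pow_mem _ ((P.add_mem_iff_right
        (P.pow_mem_of_mem (P.mul_mem_left _ hy) _ (Nat.succ_pos _))).mp hzP)
      rcases hP.mem_or_mem h1 with h | h
      · exact hyq hy h
      · exact (P.add_mem_iff_left hy).mp h
    rcases hP.mem_or_mem hmain with h | h
    · rcases hP.mem_or_mem h with h | h
      · exact ⟨hP.mem_of_pow_mem _ h, hx (hP.mem_of_pow_mem _ h)⟩
      · exact ⟨hy (hP.mem_of_pow_mem _ h), hP.mem_of_pow_mem _ h⟩
    · rw [hz] at hzP
      have h1 := hP.mem_of_pow_mem _ ((P.add_mem_iff_left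
        (P.pow_mem_of_mem (P.mul_mem_right _ h) 2 two_pos)).mp hzP)
      rcases hP.mem_or_mem h1 with h | h
      · exact ⟨h, hx h⟩
      · exact ⟨hy h, h⟩
  simp only [Ideal.radical_eq_sInf, Submodule.mem_sInf, Set.mem_ofPred_eq]
  have hmem : ∀ P : Ideal F, 𝔞 ⊔ Ideal.span {z} ≤ P → 𝔞 ≤ P ∧ z ∈ P := fun P hP =>
    ⟨le_sup_left.trans hP, hP (Ideal.mem_sup_right (Ideal.mem_span_singleton_self z))⟩
  exact ⟨fun P hP => (key P hP.2 (hmem P hP.1).1 (hmem P hP.1).2).1,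
    fun P hP => (key P hP.2 (hmem P hP.1).1 (hmem P hP.1).2).2⟩

/-! ### Principal reductions of powers of an ideal -/

noncomputable section

open Polynomial

variable {R : Type*} [CommRing R]

/-- The degree `k` part `I ^ k t ^ k` of the Rees algebra of `I`. -/
def reesDegree (I : Ideal R) (k : ℕ) : Submodule R (reesAlgebra I) :=
  (LinearMap.range (monomial (R := R) k)).comap (reesAlgebra I).val.toLinearMap

theorem mul_mem_reesDegree {I : Ideal R} {k l : ℕ} {v w : reesAlgebra I} (hv : v ∈ reesDegree I k)
    (hw : w ∈ reesDegree I l) : v * w ∈ reesDegree I (k + l) := by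
  obtain ⟨r, hr⟩ := hv
  obtain ⟨s, hs⟩ := hw
  exact ⟨r * s, by rw [← monomial_mul_monomial, hr, hs]; rfl⟩

theorem pow_mem_reesDegree {I : Ideal R} {k : ℕ} {v : reesAlgebra I} (hv : v ∈ reesDegree I k)
    (n : ℕ) : v ^ n ∈ reesDegree I (k * n) := by
  obtain ⟨r, hr⟩ := hv
  exact ⟨r ^ n, by rw [← monomial_pow, hr]; rfl⟩

theorem exists_mem_map_algebraMap_reesAlgebra {I J : Ideal R} {n : ℕ} {r : R} (hr : r ∈ J * I ^ n) :
    ∃ w ∈ J.map (algebraMap R (reesAlgebra I)), (w : R[X]) = monomial n r := by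
  induction hr using Submodule.mul_induction_on' with
  | mem_mul_mem a ha b hb =>
    refine ⟨algebraMap R _ a * ⟨monomial n b, reesAlgebra.monomial_mem.mpr hb⟩,
      Ideal.mul_mem_right _ _ (Ideal.mem_map_of_mem _ ha), ?_⟩
    simp [← Polynomial.C_mul_monomial]
  | add x _ y _ hx hy =>
    obtain ⟨v, hv, hv'⟩ := hx
    obtain ⟨w, hw, hw'⟩ := hy
    exact ⟨v + w, Ideal.add_mem _ hv hw, by simp [hv', hw']⟩

theorem coeff_mem_of_mem_map_algebraMap_reesAlgebra {I J : Ideal R} {w : reesAlgebra I}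
    (hw : w ∈ J.map (algebraMap R (reesAlgebra I))) (n : ℕ) : (w : R[X]).coeff n ∈ J * I ^ n := by
  induction hw using Submodule.span_induction generalizing n with
  | mem x hx =>
    obtain ⟨a, ha, rfl⟩ := hx
    change (C a).coeff n ∈ _
    rw [coeff_C]
    split_ifs with h
    · subst h
      simpa using ha
    · exact zero_mem _
  | zero => simp
  | add x y _ _ hx hy => simpa using add_mem (hx n) (hy n)
  | smul f x _ hx =>
    change ((f : R[X]) * (x : R[X])).coeff n ∈ _
    rw [coeff_mul]
    refine sum_mem fun p hp => ?_
    rw [← Finset.HasAntidiagonal.mem_antidiagonal.mp hp, pow_add, mul_left_comm]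
    exact Ideal.mul_mem_mul (f.2 _) (hx _)

/-- The ideal of the Rees algebra generated by its elements of degree one. -/
def reesIrrelevant (I : Ideal R) : Ideal (reesAlgebra I) := Ideal.span (reesDegree I 1)

theorem monomial_mem_reesIrrelevant_pow {I : Ideal R} {n : ℕ} {r : R} (hr : r ∈ I ^ n) :
    (⟨monomial n r, reesAlgebra.monomial_mem.mpr hr⟩ : reesAlgebra I) ∈ reesIrrelevant I ^ n := by
  induction n generalizing r with
  | zero => simp
  | succ n ih =>
    suffices ∃ w ∈ reesIrrelevant I ^ (n + 1), (w : R[X]) = monomial (n + 1) r by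
      obtain ⟨w, hw, hw'⟩ := this
      convert hw
      exact hw'.symm
    rw [pow_succ] at hr
    induction hr using Submodule.mul_induction_on' with
    | mem_mul_mem a ha b hb =>
      let w : reesAlgebra I := ⟨monomial 1 b, reesAlgebra.monomial_mem.mpr (by simpa using hb)⟩
      have hw : w ∈ reesIrrelevant I := Ideal.subset_span ⟨b, rfl⟩
      refine ⟨_, pow_succ (reesIrrelevant I) n ▸ Ideal.mul_mem_mul (ih ha) hw, ?_⟩
      exact monomial_mul_monomial _ _ _ _
    | add x _ y _ hx hy =>
      obtain ⟨v, hv, hv'⟩ := hx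
      obtain ⟨w, hw, hw'⟩ := hy
      exact ⟨v + w, Ideal.add_mem _ hv hw, by simp [hv', hw']⟩

variable [IsLocalRing R] [IsNoetherianRing R]

/-- If the residual ranks of the powers of `I` are bounded, then two elements of a power of `I`
satisfy a binary form that is nontrivial modulo the maximal ideal, up to `𝔪 I ^ N`. -/
theorem exists_sum_mem_maximalIdeal_mul {I : Ideal R} {e : ℕ}
    (he : ∀ n, Module.length R (↥(I ^ n) ⧸ (IsLocalRing.maximalIdeal R • ⊤ : Submodule R ↥(I ^ n)))
      ≤ e) {k : ℕ} {x y : R} (hx : x ∈ I ^ k) (hy : y ∈ I ^ k) :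
    ∃ c : ℕ → R, (∃ i ≤ e, c i ∉ IsLocalRing.maximalIdeal R) ∧
      ∑ i ∈ Finset.range (e + 1), c i • (x ^ i * y ^ (e - i)) ∈
        IsLocalRing.maximalIdeal R * I ^ (k * e) := by
  let m := IsLocalRing.maximalIdeal R
  let J := I ^ (k * e)
  let V := ↥J ⧸ (m • ⊤ : Submodule R J)
  let _ : Field (R ⧸ m) := Ideal.Quotient.field m
  have hmem : ∀ i < e + 1, x ^ i * y ^ (e - i) ∈ J := by
    intro i hi
    have h := Ideal.mul_mem_mul (Ideal.pow_mem_pow hx i) (Ideal.pow_mem_pow hy (e - i))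
    rwa [← pow_mul, ← pow_mul, ← pow_add, ← mul_add, Nat.add_sub_cancel' (by omega)] at h
  let v : Fin (e + 1) → V := fun i => Submodule.Quotient.mk ⟨_, hmem i i.2⟩
  have hdim : Module.finrank (R ⧸ m) V ≤ e := by
    have h := he (k * e)
    have : Module.Finite (R ⧸ m) V := .of_restrictScalars_finite R _ _
    rw [Module.length_eq_of_surjective (R := R ⧸ m) Ideal.Quotient.mk_surjective,
      Module.length_eq_finrank] at h
    exact_mod_cast h
  have hdep : ¬ LinearIndependent (R ⧸ m) v := fun hli => by
    have := hli.fintype_card_le_finrank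
    simp only [Fintype.card_fin] at this
    omega
  obtain ⟨g, hg, i₀, hi₀⟩ := Fintype.not_linearIndependent_iff.mp hdep
  choose c hc using fun i => Ideal.Quotient.mk_surjective (g i)
  refine ⟨fun i => if h : i < e + 1 then c ⟨i, h⟩ else 0, ⟨i₀, by omega, ?_⟩, ?_⟩
  · simp only [i₀.2, dif_pos]
    exact fun h => hi₀ (hc i₀ ▸ Ideal.Quotient.eq_zero_iff_mem.mpr h)
  · have h0 : (Submodule.Quotient.mk (∑ i : Fin (e + 1), c i • (⟨_, hmem i i.2⟩ : J)) : V) = 0 := by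
      rw [← hg, ← Submodule.mkQ_apply, map_sum]
      refine Finset.sum_congr rfl fun i _ => ?_
      rw [← hc i, map_smul]
      rfl
    rw [Submodule.Quotient.mk_eq_zero, Submodule.mem_smul_top_iff] at h0
    have heq : ∑ i : Fin (e + 1), (if h : (i : ℕ) < e + 1 then c ⟨i, h⟩ else 0) •
        (x ^ (i : ℕ) * y ^ (e - i)) = ↑(∑ i : Fin (e + 1), c i • (⟨_, hmem i i.2⟩ : J)) := by
      rw [AddSubmonoidClass.coe_finsetSum]
      exact Finset.sum_congr rfl fun i _ => by simp [i.2]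
    rw [Finset.sum_range, heq]
    exact h0

/-- Two homogeneous elements of positive degree of the Rees algebra lie, modulo the maximal ideal
of `R`, in the radical of a single homogeneous element of positive degree. -/
theorem exists_reesDegree_mem_radical {I : Ideal R} {e : ℕ}
    (he : ∀ n, Module.length R (↥(I ^ n) ⧸ (IsLocalRing.maximalIdeal R • ⊤ : Submodule R ↥(I ^ n)))
      ≤ e) {k l : ℕ} (hk : 0 < k) (hl : 0 < l) {v w : reesAlgebra I} (hv : v ∈ reesDegree I k)
    (hw : w ∈ reesDegree I l) :
    ∃ m > 0, ∃ z ∈ reesDegree I m,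
      v ∈ ((IsLocalRing.maximalIdeal R).map (algebraMap R (reesAlgebra I)) ⊔
        Ideal.span {z}).radical ∧
      w ∈ ((IsLocalRing.maximalIdeal R).map (algebraMap R (reesAlgebra I)) ⊔
        Ideal.span {z}).radical := by
  set 𝔞 := (IsLocalRing.maximalIdeal R).map (algebraMap R (reesAlgebra I)) with h𝔞
  -- `v ^ l` and `w ^ k` have the same degree.
  obtain ⟨r, hr⟩ := pow_mem_reesDegree hv l
  obtain ⟨s, hs⟩ := pow_mem_reesDegree hw k
  have hvl := pow_mem_reesDegree hv l
  have hwk := pow_mem_reesDegree hw k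
  rw [mul_comm l k] at hs hwk
  have hrI : r ∈ I ^ (k * l) := reesAlgebra.monomial_mem.mp (hr ▸ (v ^ l).2)
  have hsI : s ∈ I ^ (k * l) := reesAlgebra.monomial_mem.mp (hs ▸ (w ^ k).2)
  obtain ⟨c, hc, hsum⟩ := exists_sum_mem_maximalIdeal_mul he hrI hsI
  obtain ⟨g, hg, hg'⟩ := exists_mem_map_algebraMap_reesAlgebra hsum
  have hrel : ∑ i ∈ Finset.range (e + 1), c i • ((v ^ l) ^ i * (w ^ k) ^ (e - i)) ∈ 𝔞 := by
    convert hg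
    apply Subtype.ext
    rw [hg', map_sum]
    change (reesAlgebra I).val _ = _
    rw [map_sum]
    refine Finset.sum_congr rfl fun i hi => ?_
    have hi' : k * l * i + k * l * (e - i) = k * l * e := by
      rw [← mul_add]
      congr 1
      simp only [Finset.mem_range] at hi
      omega
    rw [map_smul, map_mul, map_pow, map_pow, map_smul]
    change c i • (((v ^ l : reesAlgebra I) : R[X]) ^ i * ((w ^ k : reesAlgebra I) : R[X]) ^ (e - i))
      = _
    rw [show ((v ^ l : reesAlgebra I) : R[X]) = _ from hr.symm,
      show ((w ^ k : reesAlgebra I) : R[X]) = _ from hs.symm, monomial_pow, monomial_pow,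
      monomial_mul_monomial, hi']
  obtain ⟨d, c', hz⟩ := exists_mem_radical_of_sum_mem (h𝔞 ▸ le_rfl) hc hrel
  obtain ⟨h1, h2⟩ := hz _ rfl
  refine ⟨k * l * (2 * (d + 1)), by positivity, _, ?_, Ideal.mem_radical_of_pow_mem h1,
    Ideal.mem_radical_of_pow_mem h2⟩
  refine add_mem ?_ ?_
  · have := pow_mem_reesDegree (mul_mem_reesDegree hvl hwk) (d + 1)
    convert this using 2
    ring
  · have hq : ∑ j ∈ Finset.range (d + 1), c' j • ((v ^ l) ^ j * (w ^ k) ^ (d - j)) ∈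
        reesDegree I (k * l * d) := by
      refine sum_mem fun j hj => Submodule.smul_mem _ _ ?_
      have := mul_mem_reesDegree (pow_mem_reesDegree hvl j) (pow_mem_reesDegree hwk (d - j))
      rwa [← mul_add, Nat.add_sub_cancel' (by simp only [Finset.mem_range] at hj; omega)] at this
    have := pow_mem_reesDegree (mul_mem_reesDegree hq (add_mem hvl hwk)) 2
    convert this using 2
    ring

/-- If the residual ranks of the powers of `I` are bounded, then some power of `I` has a principal
reduction. Passing to a power makes this hold over a finite residue field as well. -/
theorem exists_pow_eq_span_singleton_mul {I : Ideal R} {e : ℕ}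
    (he : ∀ n, Module.length R (↥(I ^ n) ⧸ (IsLocalRing.maximalIdeal R • ⊤ : Submodule R ↥(I ^ n)))
      ≤ e) :
    ∃ k > 0, ∃ x ∈ I ^ k, ∃ n, I ^ (n + k) = Ideal.span {x} * I ^ n := by
  classical
  set 𝔞 := (IsLocalRing.maximalIdeal R).map (algebraMap R (reesAlgebra I)) with h𝔞
  obtain ⟨s, hsI, hs⟩ := (Submodule.fg_span_iff_fg_span_finset_subset _).mp
    (IsNoetherian.noetherian (reesIrrelevant I))
  -- Combine the generators of degree one, two elements at a time.
  have key : ∀ t : Finset (reesAlgebra I), (∀ v ∈ t, v ∈ reesDegree I 1) →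
      ∃ k > 0, ∃ z ∈ reesDegree I k, ∀ v ∈ t, v ∈ (𝔞 ⊔ Ideal.span {z}).radical := by
    intro t
    induction t using Finset.induction_on with
    | empty => exact fun _ => ⟨1, one_pos, 0, zero_mem _, by simp⟩
    | insert v t _ ih =>
      intro ht
      obtain ⟨k, hk, z, hz, hzt⟩ := ih fun v hv => ht v (Finset.mem_insert_of_mem hv)
      obtain ⟨m, hm, y, hy, h1, h2⟩ := exists_reesDegree_mem_radical he hk one_pos hz
        (ht v (Finset.mem_insert_self _ _))
      refine ⟨m, hm, y, hy, fun u hu => ?_⟩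
      rcases Finset.mem_insert.mp hu with rfl | hu
      · exact h2
      · refine Ideal.radical_le_radical_iff.mpr ?_ (hzt u hu)
        refine sup_le (le_sup_left.trans Ideal.le_radical) ?_
        rwa [Ideal.span_singleton_le_iff_mem]
  obtain ⟨k, hk, z, ⟨x, hx⟩, hzs⟩ := key s fun v hv => hsI hv
  have hxI : x ∈ I ^ k := reesAlgebra.monomial_mem.mp (hx ▸ z.2)
  have hirr : reesIrrelevant I ≤ (𝔞 ⊔ Ideal.span {z}).radical := by
    exact hs.trans_le (Submodule.span_le.mpr hzs)
  -- So every `rtⁿ` of large degree `n` lies in `𝔪 F + zF`; compare coefficients and apply Nakayama.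
  obtain ⟨M, hM⟩ := Ideal.exists_pow_le_of_le_radical_of_fg hirr (IsNoetherian.noetherian _)
  refine ⟨k, hk, x, hxI, M, le_antisymm ?_ ?_⟩
  · refine Submodule.le_of_le_smul_of_le_jacobson_bot (I := IsLocalRing.maximalIdeal R)
      (IsNoetherian.noetherian _) (IsLocalRing.maximalIdeal_le_jacobson _) fun r hr => ?_
    have h1 := hM (Ideal.pow_le_pow_right (Nat.le_add_right M k) (monomial_mem_reesIrrelevant_pow hr))
    obtain ⟨a, ha, b, hb, hab⟩ := Submodule.mem_sup.mp h1
    obtain ⟨g, rfl⟩ := Ideal.mem_span_singleton.mp hb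
    have h2 : r = (a : R[X]).coeff (M + k) + x * (g : R[X]).coeff M := by
      have := congrArg (fun f : reesAlgebra I => (f : R[X]).coeff (M + k)) hab
      simp only [coeff_monomial_same, Subalgebra.coe_add, Subalgebra.coe_mul, coeff_add,
        show (z : R[X]) = _ from hx.symm, coeff_monomial_mul] at this
      exact this.symm
    rw [h2, add_comm (coeff _ _)]
    exact Submodule.add_mem_sup (Ideal.mul_mem_mul (Ideal.mem_span_singleton_self x) (g.2 M))
      (coeff_mem_of_mem_map_algebraMap_reesAlgebra ha _)
  · rw [add_comm, pow_add]
    exact Ideal.mul_mono_left ((Ideal.span_singleton_le_iff_mem _).mpr hxI)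

end

/-! ### Stable ideals are the invertible ones -/

section

variable {R : Type u} [CommRing R]

/-- The number of generators of every power of a regular ideal is at most the length of `R / c`: as
`c` is a parameter, `J / 𝔪J` is a quotient of `J / cJ`, which has the length of `R / c`. -/
theorem exists_length_pow_quotient_le [IsLocalRing R] [IsNoetherianRing R] [Ring.KrullDimLE 1 R]
    {c : R} (hcm : c ∈ IsLocalRing.maximalIdeal R) (hc : c ∈ nonZeroDivisors R) {I : Ideal R}
    (hreg : IsRegularIdeal I) : ∃ e : ℕ, ∀ n,
    Module.length R (↥(I ^ n) ⧸ (IsLocalRing.maximalIdeal R • ⊤ : Submodule R ↥(I ^ n))) ≤ e := by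
  obtain ⟨a, ha, ha'⟩ := hreg
  have htop : Module.length R (R ⧸ LinearMap.range (LinearMap.lsmul R R c)) ≠ ⊤ :=
    length_ne_top_of_smul_eq_zero hc fun x => by
      obtain ⟨x, rfl⟩ := Submodule.mkQ_surjective _ x
      exact (Submodule.Quotient.mk_eq_zero _).mpr ⟨x, rfl⟩
  refine ⟨(Module.length R (R ⧸ LinearMap.range (LinearMap.lsmul R R c))).toNat, fun n => ?_⟩
  have hle : LinearMap.range (LinearMap.lsmul R ↥(I ^ n) c) ≤ IsLocalRing.maximalIdeal R • ⊤ := by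
    rintro _ ⟨x, rfl⟩
    exact Submodule.smul_mem_smul hcm trivial
  rw [ENat.natCast_toNat htop, ← length_quotient_range_lsmul_eq
    (fun x hx => (mem_nonZeroDivisors_iff.mp hc).1 x hx) (I ^ n).subtype
    (Submodule.subtype_injective _) (length_ne_top_of_smul_eq_zero (pow_mem ha' n) fun x => ?_)]
  · exact Module.length_le_of_surjective _ (Submodule.factor_surjective hle)
  · obtain ⟨x, rfl⟩ := Submodule.mkQ_surjective _ x
    exact (Submodule.Quotient.mk_eq_zero _).mpr
      ⟨⟨a ^ n * x, Ideal.mul_mem_right _ _ (Ideal.pow_mem_pow ha n)⟩, rfl⟩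

variable {Q : Type u} [CommRing Q] [Algebra R Q]

theorem toSubmodule_colonAlgebra (I : Ideal R) :
    Subalgebra.toSubmodule (colonAlgebra Q I) =
      IsLocalization.coeSubmodule Q I / IsLocalization.coeSubmodule Q I := rfl

theorem coeSubmodule_pow (I : Ideal R) (n : ℕ) :
    IsLocalization.coeSubmodule Q (I ^ n) = IsLocalization.coeSubmodule Q I ^ n := by
  induction n with
  | zero => rw [pow_zero, pow_zero, Ideal.one_eq_top, IsLocalization.coeSubmodule_top]
  | succ n ih => rw [pow_succ, pow_succ, IsLocalization.coeSubmodule_mul, ih]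

theorem mul_colonAlgebra (I : Ideal R) :
    IsLocalization.coeSubmodule Q I * Subalgebra.toSubmodule (colonAlgebra Q I) =
      IsLocalization.coeSubmodule Q I := by
  refine le_antisymm (Submodule.mul_le.mpr fun x hx a ha => ?_) fun x hx => ?_
  · rw [mul_comm]
    exact Submodule.mem_div_iff_forall_mul_mem.mp ha x hx
  · rw [← mul_one x]
    exact Submodule.mul_mem_mul hx (one_mem (colonAlgebra Q I))

/-- An ideal `I` is invertible over `A = I : I` if `I (A : I) = A`; it is enough that `1` lies in
this product. -/
theorem mul_div_eq_of_one_mem {I : Ideal R}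
    (h : 1 ∈ IsLocalization.coeSubmodule Q I *
      (Subalgebra.toSubmodule (colonAlgebra Q I) / IsLocalization.coeSubmodule Q I)) :
    IsLocalization.coeSubmodule Q I *
      (Subalgebra.toSubmodule (colonAlgebra Q I) / IsLocalization.coeSubmodule Q I) =
      Subalgebra.toSubmodule (colonAlgebra Q I) := by
  refine le_antisymm (Submodule.mul_le.mpr fun x hx y hy => ?_) fun a ha => ?_
  · rw [mul_comm]
    exact Submodule.mem_div_iff_forall_mul_mem.mp hy x hx
  · have := Submodule.mul_mem_mul ha h
    rwa [mul_one, ← mul_assoc, mul_comm (Subalgebra.toSubmodule _), mul_colonAlgebra] at this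

theorem isStableIdeal_of_one_mem {I : Ideal R}
    (h : 1 ∈ IsLocalization.coeSubmodule Q I *
      (Subalgebra.toSubmodule (colonAlgebra Q I) / IsLocalization.coeSubmodule Q I)) :
    IsStableIdeal Q I := by
  refine Set.Subset.antisymm (Set.iUnion_subset fun n x hx => ?_)
    (Set.subset_iUnion_of_subset 1 (by rw [pow_one]))
  cases n with
  | zero =>
    obtain ⟨j, -, hj⟩ := mem_colonAlgebra_iff.mp hx 1 (by simp)
    rw [map_one, mul_one] at hj
    exact hj ▸ (colonAlgebra Q I).algebraMap_mem j
  | succ k =>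
    -- `I = I ^ (k + 1) (A : I) ^ k`, so `I ^ (k + 1) : I ^ (k + 1)` acts on `I`.
    have hpow : ∀ k : ℕ, IsLocalization.coeSubmodule Q I ^ (k + 1) *
        (Subalgebra.toSubmodule (colonAlgebra Q I) / IsLocalization.coeSubmodule Q I) ^ k =
        IsLocalization.coeSubmodule Q I := by
      intro k
      induction k with
      | zero => simp
      | succ k ih =>
        rw [pow_succ _ (k + 1), pow_succ (_ / _) k, mul_mul_mul_comm, ih, mul_div_eq_of_one_mem h,
          mul_colonAlgebra]
    have hx' : x ∈ IsLocalization.coeSubmodule Q (I ^ (k + 1)) /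
      IsLocalization.coeSubmodule Q (I ^ (k + 1)) := hx
    rw [coeSubmodule_pow] at hx'
    change x ∈ IsLocalization.coeSubmodule Q I / IsLocalization.coeSubmodule Q I
    refine Submodule.mem_div_iff_forall_mul_mem.mpr fun y hy => ?_
    rw [← hpow k] at hy ⊢
    induction hy using Submodule.mul_induction_on' with
    | mem_mul_mem u hu v hv =>
      rw [← mul_assoc]
      exact Submodule.mul_mem_mul (Submodule.mem_div_iff_forall_mul_mem.mp hx' u hu) hv
    | add u _ v _ hu hv => rw [mul_add]; exact add_mem hu hv

variable [IsFractionRing R Q]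

/-- A stable ideal is invertible over `I : I`: if `x` generates a reduction of `I ^ k`, then
`I ^ k / x` is contained in some `I ^ n : I ^ n = I : I`. -/
theorem one_mem_of_isStableIdeal [IsLocalRing R] [IsNoetherianRing R] [Ring.KrullDimLE 1 R]
    {c : R} (hcm : c ∈ IsLocalRing.maximalIdeal R) (hc : c ∈ nonZeroDivisors R) {I : Ideal R}
    (hreg : IsRegularIdeal I) (hstab : IsStableIdeal Q I) :
    1 ∈ IsLocalization.coeSubmodule Q I *
      (Subalgebra.toSubmodule (colonAlgebra Q I) / IsLocalization.coeSubmodule Q I) := by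
  obtain ⟨e, he⟩ := exists_length_pow_quotient_le hcm hc hreg
  obtain ⟨k, hk, x, hx, n, hn⟩ := exists_pow_eq_span_singleton_mul he
  obtain ⟨a, ha, ha'⟩ := hreg
  have hx' : x ∈ nonZeroDivisors R := by
    have h1 : a ^ (n + k) ∈ Ideal.span {x} * I ^ n := hn ▸ Ideal.pow_mem_pow ha _
    obtain ⟨z, hz, hzx⟩ := Ideal.mem_span_singleton_mul.mp h1
    exact (mul_mem_nonZeroDivisors.mp (hzx ▸ pow_mem ha' (n + k))).1
  obtain ⟨u, hu⟩ := isUnit_algebraMap_of_mem_nonZeroDivisors Q hx'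
  have hmem : ∀ y ∈ I ^ k, ↑u⁻¹ * algebraMap R Q y ∈ colonAlgebra Q I := by
    intro y hy
    have h1 : ↑u⁻¹ * algebraMap R Q y ∈ colonAlgebra Q (I ^ n) := by
      refine mem_colonAlgebra_iff.mpr fun i hi => ?_
      have h2 : i * y ∈ Ideal.span {x} * I ^ n := by
        rw [← hn, pow_add]
        exact Ideal.mul_mem_mul hi hy
      obtain ⟨z, hz, hzx⟩ := Ideal.mem_span_singleton_mul.mp h2
      refine ⟨z, hz, ?_⟩
      rw [mul_assoc, Units.eq_inv_mul_iff_mul_eq, hu, ← map_mul, ← map_mul, hzx, mul_comm]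
    have h2 := Set.mem_iUnion_of_mem (s := fun n : ℕ => (colonAlgebra Q (I ^ n) : Set Q)) n h1
    rwa [hstab] at h2
  -- `x ∈ I I ^ (k - 1)`, and `I ^ (k - 1) / x` is contained in `A : I`.
  have key : ∀ y ∈ I * I ^ (k - 1), ↑u⁻¹ * algebraMap R Q y ∈ IsLocalization.coeSubmodule Q I *
      (Subalgebra.toSubmodule (colonAlgebra Q I) / IsLocalization.coeSubmodule Q I) := by
    intro y hy
    induction hy using Submodule.mul_induction_on' with
    | mem_mul_mem i hi z hz =>
      rw [map_mul, mul_left_comm]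
      refine Submodule.mul_mem_mul ⟨i, hi, rfl⟩ (Submodule.mem_div_iff_forall_mul_mem.mpr ?_)
      rintro _ ⟨j, hj, rfl⟩
      rw [Algebra.linearMap_apply, mul_assoc, ← map_mul]
      refine hmem _ ?_
      have := Ideal.mul_mem_mul hz hj
      rwa [← pow_succ, Nat.sub_add_cancel hk] at this
    | add v _ w _ hv hw => rw [map_add, mul_add]; exact add_mem hv hw
  have h1 := key x (by rwa [← pow_succ', Nat.sub_add_cancel hk])
  rwa [← hu, Units.inv_mul] at h1

/-- A proper regular ideal `T` of a finite birational extension `S` of `R` satisfies `S : T ≠ S`: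
a maximal ideal over `T` is associated to `S / aS` for any regular `a ∈ T`. -/
theorem exists_notMem_forall_mul_mem [IsNoetherianRing R] [Ring.KrullDimLE 1 R]
    {S : Subalgebra R Q} [Module.Finite R S] {T : Ideal S} (hT : T ≠ ⊤) {a : R}
    (ha : a ∈ nonZeroDivisors R) (haT : algebraMap R S a ∈ T) :
    ∃ q : Q, q ∉ S ∧ ∀ t ∈ T, q * (t : Q) ∈ S := by
  have : IsNoetherianRing S := IsNoetherianRing.of_finite R S
  obtain ⟨n, hn, hTn⟩ := Ideal.exists_le_maximal T hT
  have hmin : n ∈ (Module.annihilator S (S ⧸ Ideal.span {algebraMap R S a})).minimalPrimes := by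
    rw [Ideal.annihilator_quotient]
    refine ⟨⟨hn.isPrime, (Ideal.span_singleton_le_iff_mem _).mpr (hTn haT)⟩, fun q hq hqn => ?_⟩
    have hqp := hq.1
    have hmax := (Ring.krullDimLE_one_iff.mp ‹_› (q.comap (algebraMap R S))
      inferInstance).resolve_left fun h => notMem_nonZeroDivisors_of_mem_mem_minimalPrimes
        (Ideal.mem_comap.mpr ((Ideal.span_singleton_le_iff_mem _).mp hq.2)) h ha
    have := Ideal.IsIntegral.isMaximal_of_isMaximal_comap (R := R) q hmax
    exact (this.eq_of_le hn.ne_top hqn).ge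
  obtain ⟨-, x, hx⟩ := isAssociatedPrime_iff.mp
    (Module.associatedPrimes.minimalPrimes_annihilator_subset_associatedPrimes S _ hmin)
  obtain ⟨x, rfl⟩ := Ideal.Quotient.mk_surjective x
  obtain ⟨u, hu⟩ := isUnit_algebraMap_of_mem_nonZeroDivisors Q ha
  refine ⟨↑u⁻¹ * x, fun hmem => ?_, fun t ht => ?_⟩
  · refine hn.ne_top ((Ideal.eq_top_iff_one _).mpr ?_)
    rw [hx, Submodule.mem_colon_singleton, one_smul, Submodule.mem_bot,
      Ideal.Quotient.eq_zero_iff_mem, Ideal.mem_span_singleton']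
    refine ⟨⟨_, hmem⟩, Subtype.ext ?_⟩
    change ↑u⁻¹ * (x : Q) * algebraMap R Q a = x
    rw [mul_right_comm, ← hu, Units.inv_mul, one_mul]
  · have h1 := hTn ht
    rw [hx, Submodule.mem_colon_singleton, Submodule.mem_bot, ← Ideal.Quotient.mk_eq_mk,
      ← Submodule.Quotient.mk_smul, Ideal.Quotient.mk_eq_mk,
      Ideal.Quotient.eq_zero_iff_mem, Ideal.mem_span_singleton'] at h1
    obtain ⟨b, hb⟩ := h1
    have hb' : (b : Q) * algebraMap R Q a = t * x := congrArg Subtype.val hb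
    convert b.2
    rw [mul_assoc, Units.inv_mul_eq_iff_eq_mul, hu, mul_comm (x : Q), ← hb', mul_comm]

/-- If `I` is reflexive over `A = I : I`, then it is invertible. With `J = A : I` the trace
`T = I J` satisfies `A : T ⊆ J : J ⊆ (A : J) : (A : J) = I : I = A`, hence `T = A`. -/
theorem one_mem_of_div_div_le [IsNoetherianRing R] [Ring.KrullDimLE 1 R] {I : Ideal R}
    (hreg : IsRegularIdeal I)
    (h : Subalgebra.toSubmodule (colonAlgebra Q I) / (Subalgebra.toSubmodule (colonAlgebra Q I) /
      IsLocalization.coeSubmodule Q I) ≤ IsLocalization.coeSubmodule Q I) :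
    1 ∈ IsLocalization.coeSubmodule Q I *
      (Subalgebra.toSubmodule (colonAlgebra Q I) / IsLocalization.coeSubmodule Q I) := by
  have := module_finite_colonAlgebra (Q := Q) hreg
  set A := Subalgebra.toSubmodule (colonAlgebra Q I) with hA
  set X := IsLocalization.coeSubmodule Q I with hX
  have hAX : X * A = X := mul_colonAlgebra I
  let T : Ideal (colonAlgebra Q I) :=
    { carrier := {t | (t : Q) ∈ X * (A / X)}
      zero_mem' := zero_mem (X * (A / X))
      add_mem' := fun hs ht => (X * (A / X)).add_mem hs ht
      smul_mem' := fun a t (ht : (t : Q) ∈ X * (A / X)) => by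
        have := Submodule.mul_mem_mul (M := A) a.2 ht
        rwa [← mul_assoc, mul_comm A, hAX] at this }
  obtain ⟨a, ha, ha'⟩ := hreg
  have haT : algebraMap R (colonAlgebra Q I) a ∈ T := by
    have h1 : (1 : Q) ∈ A / X := by
      rw [Submodule.one_mem_div]
      rintro _ ⟨i, -, rfl⟩
      exact (colonAlgebra Q I).algebraMap_mem i
    have h2 : algebraMap R Q a * 1 ∈ X * (A / X) := Submodule.mul_mem_mul ⟨a, ha, rfl⟩ h1
    rwa [mul_one] at h2
  by_contra hne
  obtain ⟨q, hq, hqT⟩ := exists_notMem_forall_mul_mem (T := T)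
    (fun htop => hne (by
      have : (1 : colonAlgebra Q I) ∈ T := htop ▸ trivial
      exact this)) ha' haT
  have hTA : X * (A / X) ≤ A := Submodule.mul_le.mpr fun x hx y hy => by
    rw [mul_comm]
    exact Submodule.mem_div_iff_forall_mul_mem.mp hy x hx
  have hqJ : ∀ y ∈ A / X, q * y ∈ A / X := fun y hy =>
    Submodule.mem_div_iff_forall_mul_mem.mpr fun x hx => by
      have h1 : x * y ∈ X * (A / X) := Submodule.mul_mem_mul hx hy
      have h2 := hqT ⟨_, hTA h1⟩ h1
      rwa [mul_assoc, mul_comm y]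
  refine hq ?_
  change q ∈ X / X
  refine Submodule.mem_div_iff_forall_mul_mem.mpr fun x hx => h ?_
  refine Submodule.mem_div_iff_forall_mul_mem.mpr fun y hy => ?_
  rw [mul_right_comm]
  exact Submodule.mem_div_iff_forall_mul_mem.mp (hqJ y hy) x hx

end

/-! ### Syzygies over `I : I` and stability -/

noncomputable section

theorem exists_sum_mul_eq_of_mem_mul {R Q : Type*} [CommRing R] [CommRing Q] [Algebra R Q]
    {X Y : Submodule R Q} {t : Q} (ht : t ∈ X * Y) :
    ∃ (κ : Type) (_ : Fintype κ) (x : κ → X) (y : κ → Y), ∑ k, (x k : Q) * (y k : Q) = t := by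
  induction ht using Submodule.mul_induction_on' with
  | mem_mul_mem a ha b hb => exact ⟨Unit, inferInstance, fun _ => ⟨a, ha⟩, fun _ => ⟨b, hb⟩, by simp⟩
  | add v _ w _ hv hw =>
    obtain ⟨κ, _, x, y, h⟩ := hv
    obtain ⟨κ', _, x', y', h'⟩ := hw
    exact ⟨κ ⊕ κ', inferInstance, Sum.elim x x', Sum.elim y y', by simp [h, h']⟩

variable {R : Type u} [CommRing R] {Q : Type u} [CommRing Q] [Algebra R Q] [IsFractionRing R Q]
  [IsLocalRing R] [IsNoetherianRing R] [Ring.KrullDimLE 1 R] {c : R} {I : Ideal R}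

/-- If `1 = ∑ bₖ yₖ` with `bₖ ∈ I` and `yₖ I ⊆ A = I : I`, then `(yₖ)` embeds `I` as a direct summand
of a free `A`-module, so modules saturated in a power of `I` are saturated in a free `A`-module. -/
theorem omegaCMTraceCat_le_omegaCMCat (hcm : c ∈ IsLocalRing.maximalIdeal R)
    (hc : c ∈ nonZeroDivisors R) (hreg : IsRegularIdeal I)
    (h : 1 ∈ IsLocalization.coeSubmodule Q I *
      (Subalgebra.toSubmodule (colonAlgebra Q I) / IsLocalization.coeSubmodule Q I)) :
    OmegaCMTraceCat R I ≤ OmegaCMCat R (colonAlgebra Q I) := by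
  intro M hM
  have := module_finite_colonAlgebra (Q := Q) hreg
  obtain ⟨_, _, hMCM⟩ := omegaCMTraceCat_le_cmCat (Q := Q) hcm hc hreg M hM
  have hMtf := ((isMCM_iff hcm hc).mp hMCM).2
  refine ⟨inferInstance, inferInstance, (isSyzygyOfMCM_iff hcm hc).mpr ?_⟩
  obtain ⟨ι, _, f, hf⟩ := (isSyzygyOfMCM_iff hcm hc).mp hM.1
  have hfI : ∀ m j, f m j ∈ I := fun m j =>
    moduleTrace_le_iff.mp hM.2 (LinearMap.proj j ∘ₗ f) m
  obtain ⟨κ, _, b, y, hby⟩ := exists_sum_mul_eq_of_mem_mul h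
  choose β hβ hβb using fun k => (b k).2
  have hyI : ∀ k, ∀ i ∈ I, (y k : Q) * algebraMap R Q i ∈ colonAlgebra Q I := fun k i hi =>
    Submodule.mem_div_iff_forall_mul_mem.mp (y k).2 _ ⟨i, hi, rfl⟩
  let F : M →ₗ[R] (ι × κ → colonAlgebra Q I) :=
    { toFun := fun m p => ⟨y p.2 * algebraMap R Q (f m p.1), hyI p.2 _ (hfI m p.1)⟩
      map_add' := fun m m' => funext fun p => Subtype.ext (by simp [mul_add])
      map_smul' := fun r m => funext fun p => Subtype.ext (by
        simp [Algebra.smul_def, mul_left_comm]) }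
  have hF : ∀ m p, (F m p : Q) = y p.2 * algebraMap R Q (f m p.1) := fun _ _ => rfl
  -- `∑ₖ bₖ (F m)_(j, k)` recovers the coordinate `(f m)_j`.
  have hsum : ∀ m j, ∑ k, algebraMap R Q (β k) * (F m (j, k) : Q) = algebraMap R Q (f m j) := by
    intro m j
    calc _ = ∑ k, (b k : Q) * (y k : Q) * algebraMap R Q (f m j) :=
          Finset.sum_congr rfl fun k _ => by rw [hF, ← hβb, ← mul_assoc]; rfl
      _ = _ := by rw [← Finset.sum_mul, hby, one_mul]
  have hFinj : Function.Injective F := fun m m' hmm => hf.injective (funext fun j =>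
    FaithfulSMul.algebraMap_injective R Q (by rw [← hsum, ← hsum, hmm]))
  refine ⟨ι × κ, inferInstance,
    { toFun := F, map_add' := F.map_add, map_smul' := fun a m => map_smul_of_isTorsionFree F a m },
    hFinj, fun r hr w m hw => ?_⟩
  have hw' : ∀ p, r • (w p : Q) = F m p := fun p => congrArg Subtype.val (congrFun hw p)
  choose g hgI hg using fun p : ι × κ => mem_colonAlgebra_iff.mp (w p).2 _ (hβ p.2)
  obtain ⟨m', hm'⟩ := hf.saturated r hr (fun j => ∑ k, g (j, k)) m (funext fun j => by
    apply FaithfulSMul.algebraMap_injective R Q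
    rw [← hsum, Pi.smul_apply, smul_eq_mul, map_mul, map_sum, Finset.mul_sum]
    refine Finset.sum_congr rfl fun k _ => ?_
    rw [hg, ← hw', Algebra.smul_def]
    ring)
  have hrm : r • m' = m := hf.injective (by
    apply funext
    intro j
    apply FaithfulSMul.algebraMap_injective R Q
    rw [LinearMap.map_smul, hm', ← hsum, Pi.smul_apply, smul_eq_mul, map_mul, map_sum,
      Finset.mul_sum]
    refine Finset.sum_congr rfl fun k _ => ?_
    rw [hg, ← hw', Algebra.smul_def]
    ring)
  refine ⟨m', smul_right_cancel_of_mem_nonZeroDivisors hr ?_⟩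
  rw [hw, ← hrm]
  exact (F.map_smul r m').symm

omit [IsLocalRing R] [IsNoetherianRing R] [Ring.KrullDimLE 1 R] in
theorem exists_eq_mul_of_isUnit_mem {X : Submodule R Q} {u : Q} (hu : IsUnit u) (huX : u ∈ X)
    (f : X →ₗ[R] Q) : ∃ q : Q, ∀ x : X, f x = q * x := by
  obtain ⟨u, rfl⟩ := hu
  refine ⟨f ⟨u, huX⟩ * ↑u⁻¹, fun x => ?_⟩
  obtain ⟨r, hr, b, hb⟩ := exists_smul_eq_algebraMap (R := R) ((x : Q) * ↑u⁻¹)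
  have h1 : r • x = b • (⟨u, huX⟩ : X) := Subtype.ext (by
    rw [Submodule.coe_smul, Submodule.coe_smul, Algebra.smul_def b, ← hb, smul_mul_assoc, mul_assoc,
      Units.inv_mul, mul_one])
  apply smul_right_cancel_of_mem_nonZeroDivisors hr
  rw [← map_smul, h1, map_smul, Algebra.smul_def, ← hb, smul_mul_assoc]
  ring_nf

omit [IsLocalRing R] [IsNoetherianRing R] [Ring.KrullDimLE 1 R] in
/-- A regular fractional ideal `X` that is saturated in a free module over a birational extension
`A` of `R` contains its bidual `A : (A : X)`. -/
theorem mem_of_isSaturatedEmbedding {A : Type*} [CommRing A] [Algebra R A] [Algebra A Q]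
    [IsScalarTower R A Q] [FaithfulSMul A Q] {X : Submodule R Q} {u : Q} (hu : IsUnit u)
    (huX : u ∈ X) {ι : Type*} {f : X →ₗ[R] (ι → A)} (hf : IsSaturatedEmbedding R f) {q : Q}
    (hq : ∀ p : Q, (∀ x ∈ X, ∃ a : A, algebraMap A Q a = p * x) →
      ∃ a : A, algebraMap A Q a = q * p) : q ∈ X := by
  choose y hy using fun j => exists_eq_mul_of_isUnit_mem hu huX
    ((IsScalarTower.toAlgHom R A Q).toLinearMap ∘ₗ LinearMap.proj j ∘ₗ f)
  choose w hw using fun j => hq (y j) fun x hx => ⟨f ⟨x, hx⟩ j, hy j ⟨x, hx⟩⟩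
  obtain ⟨u, rfl⟩ := hu
  obtain ⟨r, hr, b, hb⟩ := exists_smul_eq_algebraMap (R := R) (q * ↑u⁻¹)
  have hbu : r • q = b • (u : Q) := by
    rw [Algebra.smul_def b, ← hb, smul_mul_assoc, mul_assoc, Units.inv_mul, mul_one]
  have hrw : ∀ m : X, r • q = m → r • w = f m := fun m hm => funext fun j =>
    FaithfulSMul.algebraMap_injective A Q (by
      refine Eq.trans ?_ (hy j m).symm
      rw [← hm, Pi.smul_apply, Algebra.smul_def, map_mul, ← IsScalarTower.algebraMap_apply, hw,
        Algebra.smul_def]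
      ring)
  obtain ⟨m', hm'⟩ := hf.saturated r hr w (b • ⟨u, huX⟩) (hrw _ hbu)
  have hrm : r • m' = b • ⟨u, huX⟩ := hf.injective (by
    rw [map_smul, hm']
    exact hrw _ hbu)
  convert m'.2
  apply smul_right_cancel_of_mem_nonZeroDivisors hr
  rw [hbu]
  exact (congrArg Subtype.val hrm).symm

/-- The ideal `I`, as a module, is equivalent to its image in the total ring of fractions. -/
def coeSubmoduleEquiv (Q : Type*) [CommRing Q] [Algebra R Q] [IsFractionRing R Q] (I : Ideal R) :
    I ≃ₗ[R] IsLocalization.coeSubmodule Q I :=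
  Submodule.equivMapOfInjective (Algebra.linearMap R Q)
    (FaithfulSMul.algebraMap_injective R Q) I

theorem omegaCMTraceCat_of_ideal (Q : Type u) [CommRing Q] [Algebra R Q] [IsFractionRing R Q]
    (hcm : c ∈ IsLocalRing.maximalIdeal R)
    (hc : c ∈ nonZeroDivisors R) (hreg : IsRegularIdeal I) (hrefl : Module.IsReflexive R I)
    (htr : IsTraceIdeal I) : OmegaCMTraceCat R I (ModuleCat.of R I) := by
  have := module_finite_colonAlgebra (Q := Q) hreg
  obtain ⟨κ, _, g, hg⟩ := exists_isSaturatedEmbedding_one_div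
    (Y := Subalgebra.toSubmodule (colonAlgebra Q I)) (Module.Finite.iff_fg.mp this) isUnit_one
    (one_mem (colonAlgebra Q I)) (coeSubmodule_eq_one_div_colonAlgebra hreg hrefl htr)
  refine ⟨(isSyzygyOfMCM_iff hcm hc).mpr ⟨κ, inferInstance,
    g ∘ₗ (coeSubmoduleEquiv Q I).toLinearMap, ?_⟩, moduleTrace_le_iff.mpr fun f i => ?_⟩
  · refine ⟨hg.injective.comp (coeSubmoduleEquiv Q I).injective, fun r hr n m hn => ?_⟩
    obtain ⟨x, hx⟩ := hg.saturated r hr n _ hn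
    exact ⟨(coeSubmoduleEquiv Q I).symm x, by simpa using hx⟩
  · obtain ⟨q, hq⟩ := exists_eq_mul_algebraMap (Q := Q) hreg (Algebra.linearMap R Q ∘ₗ f)
    obtain ⟨j, hj, hji⟩ := mem_colonAlgebra_iff.mp
      (htr.mem_colonAlgebra fun i hi => ⟨_, hq ⟨i, hi⟩⟩) i i.2
    have hfj : j = f i := FaithfulSMul.algebraMap_injective R Q (hji.trans (hq i).symm)
    exact hfj ▸ hj

/-- If the ideal `I` is a syzygy over `A = I : I`, then it is reflexive over `A`. -/
theorem div_div_le_of_omegaCMCat (hcm : c ∈ IsLocalRing.maximalIdeal R)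
    (hc : c ∈ nonZeroDivisors R) (hreg : IsRegularIdeal I)
    (h : OmegaCMCat R (colonAlgebra Q I) (ModuleCat.of R I)) :
    Subalgebra.toSubmodule (colonAlgebra Q I) / (Subalgebra.toSubmodule (colonAlgebra Q I) /
      IsLocalization.coeSubmodule Q I) ≤ IsLocalization.coeSubmodule Q I := by
  obtain ⟨_, _, hI⟩ := h
  have := module_finite_colonAlgebra (Q := Q) hreg
  obtain ⟨ι, _, f, hf⟩ := (isSyzygyOfMCM_iff hcm hc).mp hI
  let f' : IsLocalization.coeSubmodule Q I →ₗ[R] (ι → colonAlgebra Q I) :=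
    f.restrictScalars R ∘ₗ (coeSubmoduleEquiv Q I).symm.toLinearMap
  have hf' : IsSaturatedEmbedding R f' := by
    refine ⟨hf.injective.comp (coeSubmoduleEquiv Q I).symm.injective, fun r hr n m hn => ?_⟩
    obtain ⟨x, hx⟩ := hf.saturated r hr n _ hn
    exact ⟨coeSubmoduleEquiv Q I x, by simpa [f'] using hx⟩
  obtain ⟨u, huI, hu⟩ := hreg.exists_isUnit (Q := Q)
  intro q hq
  refine mem_of_isSaturatedEmbedding hu huI hf' fun p hp => ?_
  exact ⟨⟨q * p, Submodule.mem_div_iff_forall_mul_mem.mp hq _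
    (Submodule.mem_div_iff_forall_mul_mem.mpr fun x hx => by
      obtain ⟨a, ha⟩ := hp x hx
      exact ha ▸ a.2)⟩, rfl⟩

theorem omegaCMCat_eq_omegaCMTraceCat_iff (hcm : c ∈ IsLocalRing.maximalIdeal R)
    (hc : c ∈ nonZeroDivisors R) (hreg : IsRegularIdeal I) (hrefl : Module.IsReflexive R I)
    (htr : IsTraceIdeal I) :
    OmegaCMCat R (colonAlgebra Q I) = OmegaCMTraceCat R I ↔ IsStableIdeal Q I := by
  refine ⟨fun h => ?_, fun h => ?_⟩
  · have hI : OmegaCMCat R (colonAlgebra Q I) (ModuleCat.of R I) :=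
      h ▸ omegaCMTraceCat_of_ideal Q hcm hc hreg hrefl htr
    exact isStableIdeal_of_one_mem
      (one_mem_of_div_div_le hreg (div_div_le_of_omegaCMCat hcm hc hreg hI))
  · exact le_antisymm (omegaCMCat_le_omegaCMTraceCat hcm hc hreg hrefl htr)
      (omegaCMTraceCat_le_omegaCMCat hcm hc hreg (one_mem_of_isStableIdeal hcm hc hreg h))

end

/-! ### Duality into a module with simple socle -/

section

variable {R : Type u} [CommRing R]

theorem exists_comp_eq_of_ker_le {M N P : Type*} [AddCommGroup M] [Module R M] [AddCommGroup N]
    [Module R N] [AddCommGroup P] [Module R P] {p : M →ₗ[R] N} (hp : Function.Surjective p)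
    {f : M →ₗ[R] P} (h : ∀ m, p m = 0 → f m = 0) : ∃ g : N →ₗ[R] P, ∀ m, g (p m) = f m := by
  refine ⟨(LinearMap.ker p).liftQ f (fun m hm => h m hm) ∘ₗ
    (p.quotKerEquivOfSurjective hp).symm.toLinearMap, fun m => ?_⟩
  have : (p.quotKerEquivOfSurjective hp).symm (p m) = Submodule.Quotient.mk m := by
    rw [LinearEquiv.symm_apply_eq]
    rfl
  rw [LinearMap.comp_apply, LinearEquiv.coe_coe, this]
  exact Submodule.liftQ_apply _ _ _

theorem length_linearMap_eq_add {N E : Type*} [AddCommGroup N] [Module R N] [AddCommGroup E]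
    [Module R E] (P : Submodule R N) :
    Module.length R (N →ₗ[R] E) = Module.length R ((N ⧸ P) →ₗ[R] E) +
      Module.length R (LinearMap.range (LinearMap.lcomp R E P.subtype)) := by
  refine Module.length_eq_add_of_exact (LinearMap.lcomp R E P.mkQ)
    (LinearMap.lcomp R E P.subtype).rangeRestrict ?_ (LinearMap.surjective_rangeRestrict _) ?_
  · intro f g hfg
    exact LinearMap.ext fun x => by
      obtain ⟨x, rfl⟩ := P.mkQ_surjective x
      exact LinearMap.congr_fun hfg x
  · intro f
    constructor
    · intro hf
      obtain ⟨g, hg⟩ := exists_comp_eq_of_ker_le P.mkQ_surjective (f := f) (fun m hm =>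
        LinearMap.congr_fun (congrArg Subtype.val hf)
          ⟨m, (Submodule.Quotient.mk_eq_zero P).mp hm⟩)
      exact ⟨g, LinearMap.ext hg⟩
    · rintro ⟨g, rfl⟩
      refine Subtype.ext (LinearMap.ext fun m => ?_)
      change g (P.mkQ m) = 0
      rw [Submodule.mkQ_apply, (Submodule.Quotient.mk_eq_zero P).mpr m.2, map_zero]

variable [IsLocalRing R] {E : Type u} [AddCommGroup E] [Module R E]

/-- If the socle of `E` is simple or zero, then dualizing into `E` does not increase lengths. -/
theorem length_linearMap_le
    (hk : Module.length R (IsLocalRing.ResidueField R →ₗ[R] E) ≤ 1) {N : Type u} [AddCommGroup N]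
    [Module R N] (hN : IsFiniteLength R N) :
    Module.length R (N →ₗ[R] E) ≤ Module.length R N := by
  induction hN with
  | of_subsingleton =>
    rw [Module.length_eq_zero (R := R)]
    exact zero_le
  | @of_simple_quotient M _ _ P _ hP ih =>
    have hsimple : Module.length R ((M ⧸ P) →ₗ[R] E) ≤ 1 := by
      obtain ⟨J, hJ, ⟨e⟩⟩ := isSimpleModule_iff_quot_maximal.mp
        (inferInstance : IsSimpleModule R (M ⧸ P))
      obtain rfl := IsLocalRing.eq_maximalIdeal hJ
      have e' : (M ⧸ P) ≃ₗ[R] IsLocalRing.ResidueField R := e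
      exact (LinearEquiv.congrLeft E R e').length_eq.trans_le hk
    rw [length_linearMap_eq_add P, Module.length_eq_add_of_exact P.subtype P.mkQ
      P.subtype_injective P.mkQ_surjective (LinearMap.exact_subtype_mkQ P),
      Module.length_eq_one R (M ⧸ P), add_comm]
    exact add_le_add ((Module.length_le_of_injective _ (Submodule.subtype_injective _)).trans ih)
      hsimple

variable [IsNoetherianRing R] [Ring.KrullDimLE 1 R] {x : R}

omit [IsLocalRing R] in
theorem isFiniteLength_of_smul_eq_zero (hx : x ∈ nonZeroDivisors R) {N : Type*} [AddCommGroup N]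
    [Module R N] [Module.Finite R N] (h : ∀ n : N, x • n = 0) : IsFiniteLength R N :=
  Module.length_ne_top_iff.mp (length_ne_top_of_smul_eq_zero hx h)

omit [IsLocalRing R] [IsNoetherianRing R] [Ring.KrullDimLE 1 R] in
theorem exists_surjective_pi_quotient_span (x : R) (n : ℕ) :
    ∃ π : (Fin n → R) →ₗ[R] (Fin n → R ⧸ Ideal.span {x}), Function.Surjective π ∧
      ∀ v, π v = 0 → ∃ w, v = x • w := by
  refine ⟨LinearMap.pi fun i => Submodule.mkQ _ ∘ₗ LinearMap.proj i, fun g =>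
    ⟨fun i => (Ideal.Quotient.mk_surjective (g i)).choose,
      funext fun i => (Ideal.Quotient.mk_surjective (g i)).choose_spec⟩, fun v hv => ?_⟩
  have h1 : ∀ i, ∃ w, x * w = v i := fun i => by
    have h2 : Ideal.Quotient.mk (Ideal.span {x}) (v i) = 0 := congrFun hv i
    obtain ⟨w, hw⟩ := Ideal.mem_span_singleton'.mp (Ideal.Quotient.eq_zero_iff_mem.mp h2)
    exact ⟨w, by rw [mul_comm, hw]⟩
  choose w hw using h1
  exact ⟨w, funext fun i => (hw i).symm⟩

omit [IsLocalRing R] [IsNoetherianRing R] [Ring.KrullDimLE 1 R] in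
theorem smul_quotient_span_eq_zero {ι : Type*} (g : ι → R ⧸ Ideal.span {x}) : x • g = 0 := by
  funext i
  obtain ⟨r, hr⟩ := Ideal.Quotient.mk_surjective (g i)
  rw [Pi.smul_apply, ← hr, Algebra.smul_def, Ideal.Quotient.algebraMap_eq, ← map_mul,
    Pi.zero_apply, Ideal.Quotient.eq_zero_iff_mem]
  exact Ideal.mul_mem_right _ _ (Ideal.mem_span_singleton_self x)

/-- Let `E` be an `R / x`-module with simple socle and the length of `R / x`. Then `E` is injective
over `R / x` and dualizing into `E` preserves lengths: for a submodule `P` of a free module `G`,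
the inequalities for `P` and `G / P` add up to an equality for `G`. -/
theorem length_linearMap_eq_and_exists_extension (hx : x ∈ nonZeroDivisors R)
    (hxE : ∀ e : E, x • e = 0)
    (hE : Module.length R E = Module.length R (R ⧸ Ideal.span {x}))
    (hk : Module.length R (IsLocalRing.ResidueField R →ₗ[R] E) ≤ 1) {n : ℕ}
    (P : Submodule R (Fin n → R ⧸ Ideal.span {x})) :
    Module.length R (((Fin n → R ⧸ Ideal.span {x}) ⧸ P) →ₗ[R] E) =
      Module.length R ((Fin n → R ⧸ Ideal.span {x}) ⧸ P) ∧
    ∀ f : P →ₗ[R] E, ∃ g : (Fin n → R ⧸ Ideal.span {x}) →ₗ[R] E, ∀ p : P, g p = f p := by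
  let G := Fin n → R ⧸ Ideal.span {x}
  have hxG : ∀ g : G, x • g = 0 := smul_quotient_span_eq_zero
  have hlG : Module.length R G ≠ ⊤ := length_ne_top_of_smul_eq_zero hx hxG
  have hG : Module.length R G ≤ Module.length R (G →ₗ[R] E) := by
    obtain ⟨π, hπ, hπk⟩ := exists_surjective_pi_quotient_span x n
    have h1 : Module.length R (Fin n → E) = Module.length R G := by
      rw [Module.length_pi_of_fintype, Module.length_pi_of_fintype]
      simp only [hE]
    rw [← h1]
    refine Module.length_le_of_surjective
      (((Pi.basisFun R (Fin n)).constr R).symm.toLinearMap ∘ₗ LinearMap.lcomp R E π) fun e => ?_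
    obtain ⟨g, hg⟩ := exists_comp_eq_of_ker_le hπ (f := (Pi.basisFun R (Fin n)).constr R e)
      (fun v hv => by
        obtain ⟨w, rfl⟩ := hπk v hv
        rw [map_smul, hxE])
    refine ⟨g, ?_⟩
    rw [LinearMap.comp_apply, LinearEquiv.coe_coe, LinearEquiv.symm_apply_eq]
    exact LinearMap.ext hg
  have hflP : IsFiniteLength R P := isFiniteLength_of_smul_eq_zero hx fun p =>
    Subtype.ext (hxG p)
  have hflQ : IsFiniteLength R (G ⧸ P) := isFiniteLength_of_smul_eq_zero hx fun q => by
    obtain ⟨g, rfl⟩ := P.mkQ_surjective q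
    rw [← map_smul, hxG, map_zero]
  have hP := length_linearMap_le hk hflP
  have hQ := length_linearMap_le hk hflQ
  have hr := Module.length_le_of_injective _ (Submodule.subtype_injective
    (LinearMap.range (LinearMap.lcomp R E P.subtype)))
  have hGP := Module.length_eq_add_of_exact P.subtype P.mkQ
      P.subtype_injective P.mkQ_surjective (LinearMap.exact_subtype_mkQ P)
  rw [length_linearMap_eq_add P, hGP] at hG
  have htopP := Module.length_ne_top_iff.mpr hflP
  have htopQ := Module.length_ne_top_iff.mpr hflQ
  have hfin : IsFiniteLength R (P →ₗ[R] E) :=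
    Module.length_ne_top_iff.mp (ne_top_of_le_ne_top htopP hP)
  have heq1 : Module.length R ((G ⧸ P) →ₗ[R] E) = Module.length R (G ⧸ P) := by
    refine le_antisymm hQ ?_
    by_contra! hlt
    refine absurd hG (not_le.mpr ?_)
    rw [add_comm]
    exact ENat.add_lt_add_of_le_of_lt (ne_top_of_le_ne_top htopP (hr.trans hP)) (hr.trans hP) hlt
  have heq2 : Module.length R (P →ₗ[R] E) ≤
      Module.length R (LinearMap.range (LinearMap.lcomp R E P.subtype)) := by
    rw [heq1, add_comm, ENat.add_le_add_iff_left htopQ] at hG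
    exact hP.trans hG
  refine ⟨heq1, fun f => ?_⟩
  obtain ⟨h1, h2⟩ := isFiniteLength_iff_isNoetherian_isArtinian.mp hfin
  have htop : LinearMap.range (LinearMap.lcomp R E P.subtype) = ⊤ := by
    by_contra hne
    exact absurd heq2 (not_le.mpr (Submodule.length_lt hne))
  obtain ⟨g, hg⟩ := (htop ▸ Submodule.mem_top : f ∈ LinearMap.range (LinearMap.lcomp R E P.subtype))
  exact ⟨g, fun p => LinearMap.congr_fun hg p⟩

/-- A module with simple socle and the length of `R / x` is a cogenerator for the finite
`R / x`-modules: if every form vanished at `v`, then `N` and `N / Rv` would have duals of the same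
length. -/
theorem exists_linearMap_apply_ne_zero (hx : x ∈ nonZeroDivisors R)
    (hxE : ∀ e : E, x • e = 0)
    (hE : Module.length R E = Module.length R (R ⧸ Ideal.span {x}))
    (hk : Module.length R (IsLocalRing.ResidueField R →ₗ[R] E) ≤ 1) {N : Type u} [AddCommGroup N]
    [Module R N] [Module.Finite R N] (hxN : ∀ n : N, x • n = 0) {v : N} (hv : v ≠ 0) :
    ∃ f : N →ₗ[R] E, f v ≠ 0 := by
  have hlen : Module.length R (N →ₗ[R] E) = Module.length R N := by
    obtain ⟨n, p, hp⟩ := Module.Finite.exists_fin' R N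
    obtain ⟨π, hπ, hπk⟩ := exists_surjective_pi_quotient_span x n
    obtain ⟨q, hq⟩ := exists_comp_eq_of_ker_le hπ (f := p) (fun v hv => by
      obtain ⟨w, rfl⟩ := hπk v hv
      rw [map_smul, hxN])
    have hqs : Function.Surjective q := fun y => by
      obtain ⟨w, rfl⟩ := hp y
      exact ⟨_, hq w⟩
    have e := q.quotKerEquivOfSurjective hqs
    rw [← (LinearEquiv.congrLeft E R e).length_eq, ← e.length_eq]
    exact (length_linearMap_eq_and_exists_extension hx hxE hE hk _).1
  by_contra! hno
  let P := Submodule.span R {v}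
  have hP0 : P ≠ ⊥ := by simpa [P] using hv
  have hflN : IsFiniteLength R N := isFiniteLength_of_smul_eq_zero hx hxN
  obtain ⟨h1, h2⟩ := isFiniteLength_iff_isNoetherian_isArtinian.mp hflN
  have hflQ : IsFiniteLength R (N ⧸ P) := isFiniteLength_of_smul_eq_zero hx fun q => by
    obtain ⟨g, rfl⟩ := P.mkQ_surjective q
    rw [← map_smul, hxN, map_zero]
  have h3 : Module.length R (N →ₗ[R] E) ≤ Module.length R ((N ⧸ P) →ₗ[R] E) := by
    refine Module.length_le_of_surjective (LinearMap.lcomp R E P.mkQ) fun f => ?_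
    refine ⟨P.liftQ f (Submodule.span_le.mpr (by simpa using hno f)), LinearMap.ext fun _ => rfl⟩
  exact absurd (h3.trans (length_linearMap_le hk hflQ))
    (not_le.mpr (hlen ▸ Submodule.length_quotient_lt P hP0))

/-! ### Duality into a canonical module -/

variable {K : Type u} [AddCommGroup K] [Module R K]

omit [IsLocalRing R] [IsNoetherianRing R] [Ring.KrullDimLE 1 R] in
theorem exists_smul_eq_of_mem_range {N : Type*} [AddCommGroup N] [Module R N]
    (hK : ∀ k : K, x • k = 0 → k = 0) {f : N →ₗ[R] K}
    (h : ∀ n, f n ∈ LinearMap.range (LinearMap.lsmul R K x)) : ∃ g : N →ₗ[R] K, x • g = f := by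
  have hinj : Function.Injective (LinearMap.lsmul R K x) :=
    (injective_iff_map_eq_zero _).mpr hK
  let e := LinearEquiv.ofInjective _ hinj
  refine ⟨e.symm.toLinearMap ∘ₗ f.codRestrict _ h, LinearMap.ext fun n => ?_⟩
  exact congrArg Subtype.val (e.apply_symm_apply (f.codRestrict _ h n))

/-- Linear forms into `K` extend from a submodule `N` of a free module `F` along which `F` has no
`x`-torsion, that is `Ext¹(F / N, K) = 0`. They extend modulo `x`, since `K / xK` is injective over
`R / x`, and Nakayama's lemma applies to the module of forms on `N`. -/
theorem exists_extension_of_saturated [Module.Finite R K] (hxm : x ∈ IsLocalRing.maximalIdeal R)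
    (hx : x ∈ nonZeroDivisors R) (hK : ∀ k : K, x • k = 0 → k = 0)
    (hE : Module.length R (K ⧸ LinearMap.range (LinearMap.lsmul R K x)) =
      Module.length R (R ⧸ Ideal.span {x}))
    (hk : Module.length R (IsLocalRing.ResidueField R →ₗ[R]
      (K ⧸ LinearMap.range (LinearMap.lsmul R K x))) ≤ 1)
    {n : ℕ} {N : Submodule R (Fin n → R)} (hN : ∀ w, x • w ∈ N → w ∈ N) (f : N →ₗ[R] K) :
    ∃ g : (Fin n → R) →ₗ[R] K, ∀ w : N, g w = f w := by
  let xK := LinearMap.range (LinearMap.lsmul R K x)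
  have hxE : ∀ e : K ⧸ xK, x • e = 0 := fun e => by
    obtain ⟨k, rfl⟩ := xK.mkQ_surjective e
    rw [← map_smul]
    exact (Submodule.Quotient.mk_eq_zero _).mpr ⟨k, rfl⟩
  suffices htop : (⊤ : Submodule R (N →ₗ[R] K)) ≤
      LinearMap.range (LinearMap.lcomp R K N.subtype) by
    obtain ⟨g, hg⟩ := htop (Submodule.mem_top (x := f))
    exact ⟨g, fun w => LinearMap.congr_fun hg w⟩
  refine Submodule.le_of_le_smul_of_le_jacobson_bot (I := IsLocalRing.maximalIdeal R)
    (IsNoetherian.noetherian _) (IsLocalRing.maximalIdeal_le_jacobson _) fun f _ => ?_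
  obtain ⟨π, -, hπk⟩ := exists_surjective_pi_quotient_span x n
  obtain ⟨f', hf'⟩ := exists_comp_eq_of_ker_le (π ∘ₗ N.subtype).surjective_rangeRestrict
    (f := xK.mkQ ∘ₗ f) (fun v hv => by
      obtain ⟨w, hw⟩ := hπk v (congrArg Subtype.val hv)
      have hwN : w ∈ N := hN w (hw ▸ v.2)
      have hvw : v = x • (⟨w, hwN⟩ : N) := Subtype.ext hw
      rw [hvw, map_smul, hxE])
  obtain ⟨Φ, hΦ⟩ := (length_linearMap_eq_and_exists_extension hx hxE hE hk _).2 f'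
  obtain ⟨ψ, hψ⟩ := Module.projective_lifting_property xK.mkQ (Φ ∘ₗ π) xK.mkQ_surjective
  obtain ⟨θ, hθ⟩ := exists_smul_eq_of_mem_range hK (f := f - ψ ∘ₗ N.subtype) (fun w => by
    refine (Submodule.Quotient.mk_eq_zero xK).mp ?_
    have h1 : xK.mkQ (ψ w) = xK.mkQ (f w) :=
      (LinearMap.congr_fun hψ w).trans ((hΦ _).trans (hf' w))
    change xK.mkQ (f w - ψ w) = 0
    rw [map_sub, h1, sub_self])
  have hf : f = LinearMap.lcomp R K N.subtype ψ + x • θ := by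
    rw [hθ]
    exact (add_sub_cancel _ _).symm
  rw [hf]
  exact Submodule.add_mem_sup ⟨ψ, rfl⟩ (Submodule.smul_mem_smul hxm Submodule.mem_top)

/-- Linear forms into `K` detect divisibility by `x` in a finite torsion-free module. A form on
`M / xM` into `K / xK` separates the class of `v` from zero; it lifts to a map `ψ` from a free cover of
`M`, and `ψ` takes values in `xK` on the relations of `M`. An extension of the quotient by `x` corrects
`ψ` to a form on `M`. -/
theorem exists_linearMap_apply_notMem [Module.Finite R K] (hxm : x ∈ IsLocalRing.maximalIdeal R)
    (hx : x ∈ nonZeroDivisors R) (hK : ∀ k : K, x • k = 0 → k = 0)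
    (hE : Module.length R (K ⧸ LinearMap.range (LinearMap.lsmul R K x)) =
      Module.length R (R ⧸ Ideal.span {x}))
    (hk : Module.length R (IsLocalRing.ResidueField R →ₗ[R]
      (K ⧸ LinearMap.range (LinearMap.lsmul R K x))) ≤ 1)
    {M : Type u} [AddCommGroup M] [Module R M] [Module.Finite R M]
    (hM : ∀ m : M, x • m = 0 → m = 0) {v : M}
    (hv : v ∉ LinearMap.range (LinearMap.lsmul R M x)) :
    ∃ f : M →ₗ[R] K, f v ∉ LinearMap.range (LinearMap.lsmul R K x) := by
  let xK := LinearMap.range (LinearMap.lsmul R K x)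
  let xM := LinearMap.range (LinearMap.lsmul R M x)
  have hxE : ∀ e : K ⧸ xK, x • e = 0 := fun e => by
    obtain ⟨k, rfl⟩ := xK.mkQ_surjective e
    rw [← map_smul]
    exact (Submodule.Quotient.mk_eq_zero _).mpr ⟨k, rfl⟩
  have hxM : ∀ e : M ⧸ xM, x • e = 0 := fun e => by
    obtain ⟨k, rfl⟩ := xM.mkQ_surjective e
    rw [← map_smul]
    exact (Submodule.Quotient.mk_eq_zero _).mpr ⟨k, rfl⟩
  obtain ⟨ψ', hψ'⟩ := exists_linearMap_apply_ne_zero hx hxE hE hk hxM (v := xM.mkQ v)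
    (fun h => hv ((Submodule.Quotient.mk_eq_zero _).mp h))
  obtain ⟨n, p, hp⟩ := Module.Finite.exists_fin' R M
  obtain ⟨ψ, hψ⟩ := Module.projective_lifting_property xK.mkQ (ψ' ∘ₗ xM.mkQ ∘ₗ p) xK.mkQ_surjective
  obtain ⟨θ, hθ⟩ := exists_smul_eq_of_mem_range hK (f := ψ ∘ₗ (LinearMap.ker p).subtype) (fun w => by
    refine (Submodule.Quotient.mk_eq_zero xK).mp ((LinearMap.congr_fun hψ w).trans ?_)
    simp)
  obtain ⟨θ', hθ'⟩ := exists_extension_of_saturated hxm hx hK hE hk (N := LinearMap.ker p)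
    (fun w hw => hM _ (by rw [← map_smul]; exact hw)) θ
  obtain ⟨φ, hφ⟩ := exists_comp_eq_of_ker_le hp (f := ψ - x • θ') (fun w hw => by
    rw [LinearMap.sub_apply, LinearMap.smul_apply, hθ' ⟨w, hw⟩, sub_eq_zero]
    exact (LinearMap.congr_fun hθ ⟨w, hw⟩).symm)
  refine ⟨φ, fun hmem => hψ' ?_⟩
  obtain ⟨w, rfl⟩ := hp v
  refine (LinearMap.congr_fun hψ w).symm.trans ?_
  have h1 : xK.mkQ (φ (p w)) = 0 := (Submodule.Quotient.mk_eq_zero _).mpr hmem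
  rw [hφ, LinearMap.sub_apply, LinearMap.smul_apply, map_sub, map_smul, hxE, sub_zero] at h1
  exact h1

end

/-! ### Canonical modules -/

section

variable {R : Type u} [CommRing R] [IsLocalRing R]

/-- The connecting map embeds the socle of `K / xK` in `Ext¹(k, K)`. -/
theorem length_residueField_linearMap_le {K : Type u} [AddCommGroup K] [Module R K] {x : R}
    (hxm : x ∈ IsLocalRing.maximalIdeal R) (hK : ∀ k : K, x • k = 0 → k = 0) :
    Module.length R (IsLocalRing.ResidueField R →ₗ[R]
      (K ⧸ LinearMap.range (LinearMap.lsmul R K x))) ≤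
    Module.length R (Abelian.Ext.{u} (ModuleCat.of R (IsLocalRing.ResidueField R))
      (ModuleCat.of R K) 1) := by
  let S : ShortComplex (ModuleCat.{u} R) := ShortComplex.mk
    (ModuleCat.ofHom (LinearMap.lsmul R K x))
    (ModuleCat.ofHom (LinearMap.range (LinearMap.lsmul R K x)).mkQ) (by
      ext k
      exact (Submodule.Quotient.mk_eq_zero _).mpr ⟨k, rfl⟩)
  have hS : S.ShortExact :=
    { exact := (ShortComplex.ShortExact.moduleCat_exact_iff_function_exact S).mpr
        (LinearMap.exact_map_mkQ_range (LinearMap.lsmul R K x))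
      mono_f := (ModuleCat.mono_iff_injective _).mpr ((injective_iff_map_eq_zero _).mpr hK)
      epi_g := (ModuleCat.epi_iff_surjective _).mpr (Submodule.mkQ_surjective _) }
  let k := ModuleCat.of R (IsLocalRing.ResidueField R)
  let δ : (IsLocalRing.ResidueField R →ₗ[R] (K ⧸ LinearMap.range (LinearMap.lsmul R K x))) →ₗ[R]
      Abelian.Ext.{u} k S.X₁ 1 :=
    { toFun := fun f => (Abelian.Ext.mk₀ (ModuleCat.ofHom f : k ⟶ S.X₃)).comp hS.extClass
        (zero_add 1)
      map_add' := fun f g => by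
        rw [← Abelian.Ext.add_comp, ← Abelian.Ext.mk₀_add]
        rfl
      map_smul' := fun r f => by
        rw [RingHom.id_apply, ← Abelian.Ext.smul_comp, ← Abelian.Ext.mk₀_smul]
        rfl }
  refine Module.length_le_of_injective δ ((injective_iff_map_eq_zero _).mpr fun f hf => ?_)
  obtain ⟨y, hy⟩ := Abelian.Ext.covariant_sequence_exact₃ k hS
    (Abelian.Ext.mk₀ (ModuleCat.ofHom f : k ⟶ S.X₃)) (zero_add 1) hf
  obtain ⟨g, rfl⟩ := (Abelian.Ext.mk₀_bijective k S.X₂).surjective y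
  -- There is no nonzero map from the residue field to `K`, on which `x` is regular.
  have hg : g = 0 := by
    ext v
    refine hK _ ?_
    have hxv : x • v = 0 := by
      rw [Algebra.smul_def, IsLocalRing.ResidueField.algebraMap_eq,
        (IsLocalRing.residue_eq_zero_iff x).mpr hxm, zero_mul]
    exact (g.hom.map_smul x v).symm.trans (by rw [hxv, map_zero])
  rw [hg, Abelian.Ext.mk₀_zero, Abelian.Ext.zero_comp] at hy
  have h0 : (ModuleCat.ofHom f : k ⟶ S.X₃) = 0 :=
    (Abelian.Ext.mk₀_bijective k S.X₃).injective (by rw [← hy, Abelian.Ext.mk₀_zero])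
  exact congrArg ModuleCat.Hom.hom h0

end

section

variable {R : Type u} [CommRing R] [IsLocalRing R] [IsNoetherianRing R] [Ring.KrullDimLE 1 R]
  {Q : Type u} [CommRing Q] [Algebra R Q] [IsFractionRing R Q] {K : Submodule R Q} {x : R}

omit [IsLocalRing R] [IsNoetherianRing R] [Ring.KrullDimLE 1 R] in
theorem smul_eq_zero_of_mem_nonZeroDivisors {M : Type*} [AddCommGroup M] [Module R M]
    [Module.IsTorsionFree R M] (hx : x ∈ nonZeroDivisors R) (m : M) (h : x • m = 0) : m = 0 :=
  smul_right_cancel_of_mem_nonZeroDivisors hx (by rw [h, smul_zero])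

omit [IsLocalRing R] [IsNoetherianRing R] [Ring.KrullDimLE 1 R] in
/-- A finite fractional ideal has a common denominator. -/
theorem exists_smul_mem_one_of_fg (hK : K.FG) :
    ∃ r ∈ nonZeroDivisors R, ∀ k ∈ K, ∃ b, r • k = algebraMap R Q b := by
  obtain ⟨n, s, rfl⟩ := Submodule.fg_iff_exists_fin_generating_family.mp hK
  obtain ⟨r, hr⟩ := IsLocalization.exist_integer_multiples_of_finite (nonZeroDivisors R) s
  refine ⟨r, r.2, fun k hk => ?_⟩
  induction hk using Submodule.span_induction with
  | mem k hk =>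
    obtain ⟨i, rfl⟩ := hk
    obtain ⟨b, hb⟩ := hr i
    exact ⟨b, hb.symm⟩
  | zero => exact ⟨0, by simp⟩
  | add k l _ _ hk hl =>
    obtain ⟨b, hb⟩ := hk
    obtain ⟨d, hd⟩ := hl
    exact ⟨b + d, by rw [smul_add, hb, hd, map_add]⟩
  | smul a k _ hk =>
    obtain ⟨b, hb⟩ := hk
    exact ⟨a * b, by rw [smul_comm, hb, map_mul, Algebra.smul_def]⟩

omit [IsLocalRing R] in
/-- For a finite fractional ideal `K` containing `R`, the modules `K / xK` and `R / xR` have the same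
length, since `K / R` has finite length. -/
theorem length_quotient_canonical_eq (hx : x ∈ nonZeroDivisors R)
    (h1 : 1 ≤ K) (hKfg : K.FG) :
    Module.length R (K ⧸ LinearMap.range (LinearMap.lsmul R K x)) =
      Module.length R (R ⧸ Ideal.span {x}) := by
  have : Module.Finite R K := Module.Finite.iff_fg.mpr hKfg
  let i : R →ₗ[R] K := (Algebra.linearMap R Q).codRestrict K fun r =>
    h1 (Submodule.mem_one.mpr ⟨r, rfl⟩)
  have hi : Function.Injective i := fun a b hab =>
    FaithfulSMul.algebraMap_injective R Q (congrArg Subtype.val hab)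
  obtain ⟨r, hr, hrK⟩ := exists_smul_mem_one_of_fg hKfg
  rw [← length_quotient_range_lsmul_eq (smul_eq_zero_of_mem_nonZeroDivisors hx) i hi
    (length_ne_top_of_smul_eq_zero hr fun q => ?_)]
  · have : LinearMap.range (LinearMap.lsmul R R x) = Ideal.span {x} := by
      ext y
      rw [Ideal.mem_span_singleton']
      simp [mul_comm]
    rw [this]
  · obtain ⟨k, rfl⟩ := Submodule.mkQ_surjective _ q
    obtain ⟨b, hb⟩ := hrK k k.2
    exact (Submodule.Quotient.mk_eq_zero _).mpr ⟨b, Subtype.ext hb.symm⟩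

/-- A fractional canonical ideal `K` detects divisibility in torsion-free modules: if every linear
form into `K` sends `v` into `xK`, then `v` is divisible by `x`. -/
theorem IsFractionalCanonicalIdeal.exists_smul_eq (hK : IsFractionalCanonicalIdeal K)
    (hdim : ringKrullDim R = 1)
    (hx : x ∈ nonZeroDivisors R) {M : Type u} [AddCommGroup M] [Module R M] [Module.Finite R M]
    [Module.IsTorsionFree R M] {v : M} (h : ∀ f : M →ₗ[R] K, ∃ k, x • k = f v) :
    ∃ m, x • m = v := by
  by_cases hxm : x ∈ IsLocalRing.maximalIdeal R
  · have := hK.isCanonicalModule.isMCM.finite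
    have hK0 : ∀ k : K, x • k = 0 → k = 0 := fun k hk =>
      smul_eq_zero_of_mem_nonZeroDivisors hx k hk
    obtain ⟨d, hd, hlen⟩ := hK.isCanonicalModule.type_one
    obtain rfl : d = 1 := by
      rw [hdim] at hd
      exact_mod_cast hd.symm
    by_contra hv
    obtain ⟨f, hf⟩ := exists_linearMap_apply_notMem hxm hx hK0
      (length_quotient_canonical_eq hx hK.one_le (Module.Finite.iff_fg.mp this))
      ((length_residueField_linearMap_le hxm hK0).trans hlen.le)
      (smul_eq_zero_of_mem_nonZeroDivisors hx) (v := v) hv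
    exact hf (h f)
  · obtain ⟨u, rfl⟩ : IsUnit x := by simpa using hxm
    exact ⟨(↑u⁻¹ : R) • v, by rw [smul_smul, Units.mul_inv, one_smul]⟩

/-- Finite regular fractional ideals are reflexive with respect to a fractional canonical ideal. -/
theorem IsFractionalCanonicalIdeal.mem_of_forall (hK : IsFractionalCanonicalIdeal K)
    (hdim : ringKrullDim R = 1) {X : Submodule R Q} (hX : X.FG)
    {u : Q} (hu : IsUnit u) (huX : u ∈ X) {q : Q} (hq : q ∈ K / (K / X)) : q ∈ X := by
  have : Module.Finite R X := Module.Finite.iff_fg.mpr hX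
  obtain ⟨v, hv⟩ := id hu
  obtain ⟨r, hr, b, hb⟩ := exists_smul_eq_algebraMap (R := R) (q * ↑v⁻¹)
  have hrq : r • q = b • u := by
    rw [Algebra.smul_def b, ← hb, smul_mul_assoc, mul_assoc, ← hv, Units.inv_mul, mul_one]
  obtain ⟨m, hm⟩ := hK.exists_smul_eq hdim hr (v := (b • ⟨u, huX⟩ : X)) (fun f => by
    obtain ⟨p, hp⟩ := exists_eq_mul_of_isUnit_mem hu huX (K.subtype ∘ₗ f)
    have hpX : p ∈ K / X := Submodule.mem_div_iff_forall_mul_mem.mpr fun y hy =>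
      hp ⟨y, hy⟩ ▸ (f ⟨y, hy⟩).2
    refine ⟨⟨q * p, Submodule.mem_div_iff_forall_mul_mem.mp hq p hpX⟩, Subtype.ext ?_⟩
    refine Eq.trans ?_ (hp _).symm
    change r • (q * p) = p * (b • u)
    rw [← hrq, mul_smul_comm, mul_comm q])
  convert m.2
  apply smul_right_cancel_of_mem_nonZeroDivisors hr
  rw [hrq]
  exact (congrArg Subtype.val hm).symm

end

/-! ### When `ΩCM(R, I)` is all of `CM(I : I)` -/

section

variable {R : Type u} [CommRing R] {Q : Type u} [CommRing Q] [Algebra R Q] [IsFractionRing R Q]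
  {I : Ideal R} {K : Submodule R Q}

omit [IsFractionRing R Q] in
/-- `I K = I` says that `K` is contained in `I : I`. -/
theorem coeSubmodule_mul_eq_iff (hK : 1 ≤ K) :
    IsLocalization.coeSubmodule Q I * K = IsLocalization.coeSubmodule Q I ↔
      K ≤ Subalgebra.toSubmodule (colonAlgebra Q I) := by
  rw [toSubmodule_colonAlgebra, Submodule.le_div_iff_mul_le, mul_comm K]
  refine ⟨le_of_eq, fun h => le_antisymm h ?_⟩
  calc IsLocalization.coeSubmodule Q I = IsLocalization.coeSubmodule Q I * 1 := (mul_one _).symm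
    _ ≤ _ := mul_le_mul_right hK _

/-- For a trace ideal `I`, the inclusion `I ⊆ R : R[K]` says that `R[K] ⊆ R : I = I : I`. -/
theorem coeSubmodule_le_one_div_iff (htr : IsTraceIdeal I) :
    IsLocalization.coeSubmodule Q I ≤
        1 / Subalgebra.toSubmodule (Algebra.adjoin R (K : Set Q)) ↔
      K ≤ Subalgebra.toSubmodule (colonAlgebra Q I) := by
  rw [Submodule.le_div_iff_mul_le, mul_comm, ← Submodule.le_div_iff_mul_le,
    ← colonAlgebra_eq_one_div htr]
  exact Algebra.adjoin_le_iff

omit [IsFractionRing R Q] in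
/-- A finite submodule of the integral closure that contains `1` has a stable power. -/
theorem exists_pow_succ_le_pow [IsNoetherianRing R] (h1 : 1 ≤ K) (hfg : K.FG)
    (hK : K ≤ Subalgebra.toSubmodule (integralClosure R Q)) : ∃ n, K ^ (n + 1) ≤ K ^ n := by
  let S := Subalgebra.toSubmodule (Algebra.adjoin R (K : Set Q))
  have hS : S.FG := by
    obtain ⟨s, rfl⟩ := hfg
    simp only [S, Algebra.adjoin_span]
    exact fg_adjoin_of_finite s.finite_toSet fun x hx => hK (Submodule.subset_span hx)
  have : Module.Finite R S := Module.Finite.iff_fg.mpr hS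
  have hpow : ∀ n, K ^ n ≤ S := by
    intro n
    induction n with
    | zero => exact Submodule.one_le.mpr (one_mem (Algebra.adjoin R (K : Set Q)))
    | succ n ih =>
      rw [pow_succ]
      exact Submodule.mul_le.mpr fun x hx y hy =>
        mul_mem (S := Subalgebra R Q) (ih hx) (Algebra.subset_adjoin hy)
  obtain ⟨n, hn⟩ := monotone_stabilizes_iff_noetherian.mpr (inferInstance : IsNoetherian R S)
    ⟨fun n => (K ^ n).comap S.subtype, fun m n hmn => Submodule.comap_mono (pow_le_pow_right₀ h1 hmn)⟩
  refine ⟨n, fun x hx => ?_⟩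
  have : (⟨x, hpow _ hx⟩ : S) ∈ (K ^ n).comap S.subtype := by
    rw [show (K ^ n).comap S.subtype = _ from hn (n + 1) n.le_succ]
    exact hx
  exact this

omit [IsFractionRing R Q] in
/-- A finite module of integral elements that contains `1` and is invertible over the birational
extension `A` is contained in `A`. -/
theorem le_of_one_mem_mul_div [IsNoetherianRing R] (h1 : 1 ≤ K) (hfg : K.FG)
    (hK : K ≤ Subalgebra.toSubmodule (integralClosure R Q)) (A : Subalgebra R Q)
    (h : 1 ∈ K * (Subalgebra.toSubmodule A / K)) : K ≤ Subalgebra.toSubmodule A := by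
  obtain ⟨n, hn⟩ := exists_pow_succ_le_pow h1 hfg hK
  set P := Subalgebra.toSubmodule A / K
  have hKP : K * P ≤ Subalgebra.toSubmodule A := by
    rw [mul_comm]
    exact Submodule.le_div_iff_mul_le.mp le_rfl
  have hpow : ∀ m, (K * P) ^ m ≤ Subalgebra.toSubmodule A := by
    intro m
    induction m with
    | zero => exact Submodule.one_le.mpr (one_mem A)
    | succ m ih =>
      rw [pow_succ]
      exact Submodule.mul_le.mpr fun x hx y hy => A.mul_mem (ih hx) (hKP hy)
  -- With `P = A : K`: `K ⊆ K (K P)ⁿ = Kⁿ⁺¹ Pⁿ = Kⁿ Pⁿ ⊆ A`.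
  calc K = K * 1 := (mul_one _).symm
    _ ≤ K * (K * P) ^ n := mul_le_mul_right (one_le_pow₀ (Submodule.one_le.mpr h)) _
    _ = K ^ (n + 1) * P ^ n := by ring
    _ ≤ K ^ n * P ^ n := mul_le_mul_left hn _
    _ = (K * P) ^ n := (mul_pow _ _ _).symm
    _ ≤ _ := hpow n

variable [IsLocalRing R] [IsNoetherianRing R] [Ring.KrullDimLE 1 R] {c : R}

omit [IsFractionRing R Q] [IsNoetherianRing R] [Ring.KrullDimLE 1 R] in
theorem IsFractionalCanonicalIdeal.fg (hK : IsFractionalCanonicalIdeal K) : K.FG :=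
  Module.Finite.iff_fg.mp hK.isCanonicalModule.isMCM.finite

/-- The endomorphism ring of a fractional canonical ideal is `R`. -/
theorem IsFractionalCanonicalIdeal.div_self_le (hK : IsFractionalCanonicalIdeal K)
    (hdim : ringKrullDim R = 1) {q : Q} (hq : ∀ k ∈ K, q * k ∈ K) :
    q ∈ (1 : Submodule R Q) :=
  hK.mem_of_forall hdim ⟨{1}, by rw [Finset.coe_singleton, Submodule.one_eq_span]⟩ isUnit_one
    (Submodule.one_le.mp le_rfl)
    (Submodule.mem_div_iff_forall_mul_mem.mpr fun k hk => hq k (by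
      simpa using Submodule.mem_div_iff_forall_mul_mem.mp hk 1 (Submodule.one_le.mp le_rfl)))

/-- The canonical module `K : A` of `A = I : I`, with its `A`-module structure. -/
def canonicalColon (A : Subalgebra R Q) (K : Submodule R Q) : Submodule A Q where
  carrier := (K / Subalgebra.toSubmodule A : Submodule R Q)
  add_mem' := fun ha hb => Submodule.add_mem _ ha hb
  zero_mem' := Submodule.zero_mem _
  smul_mem' := fun a x hx => Submodule.mem_div_iff_forall_mul_mem.mpr fun y hy => by
    have := Submodule.mem_div_iff_forall_mul_mem.mp hx (a * y) (A.mul_mem a.2 hy)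
    rwa [Algebra.smul_def, mul_comm _ x, mul_assoc]

theorem cmCat_canonicalColon (hK : IsFractionalCanonicalIdeal K)
    (hcm : c ∈ IsLocalRing.maximalIdeal R) (hc : c ∈ nonZeroDivisors R) (hreg : IsRegularIdeal I) :
    CMCat R (colonAlgebra Q I) (ModuleCat.of R (canonicalColon (colonAlgebra Q I) K)) := by
  have := module_finite_colonAlgebra (Q := Q) hreg
  have hfg : Module.Finite R (canonicalColon (colonAlgebra Q I) K) :=
    Module.Finite.iff_fg.mpr (fg_of_isUnit_mul_mem
      (X := (canonicalColon (colonAlgebra Q I) K).restrictScalars R) hK.fg isUnit_one fun x hx => by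
      rw [one_mul]
      simpa using Submodule.mem_div_iff_forall_mul_mem.mp hx 1 (one_mem (colonAlgebra Q I)))
  refine ⟨inferInstanceAs (Module (colonAlgebra Q I) (canonicalColon (colonAlgebra Q I) K)),
    inferInstanceAs (IsScalarTower R (colonAlgebra Q I) (canonicalColon (colonAlgebra Q I) K)),
    ?_⟩
  refine (isMCM_iff (R := R) (M := canonicalColon (colonAlgebra Q I) K) hcm hc).mpr
    ⟨Module.Finite.of_restrictScalars_finite R _ _, ?_⟩
  exact isTorsionFree_iff_mem_nonZeroDivisors.mpr fun r hr x hx =>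
    smul_right_cancel_of_mem_nonZeroDivisors hr (by rw [hx, smul_zero])

/-- If the canonical module `ω = K : A` is a syzygy over `R`, hence reflexive over `R`, then `K A` is
invertible over `A`. -/
theorem one_mem_mul_div_of_isSyzygyOfMCM (hK : IsFractionalCanonicalIdeal K)
    (hdim : ringKrullDim R = 1) (hcm : c ∈ IsLocalRing.maximalIdeal R)
    (hc : c ∈ nonZeroDivisors R) (hreg : IsRegularIdeal I)
    (h : IsSyzygyOfMCM R (canonicalColon (colonAlgebra Q I) K)) :
    1 ∈ K * (Subalgebra.toSubmodule (colonAlgebra Q I) / K) := by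
  have := module_finite_colonAlgebra (Q := Q) hreg
  set A := colonAlgebra Q I
  have hAfg : (Subalgebra.toSubmodule A).FG := Module.Finite.iff_fg.mp this
  have h1K : (1 : Q) ∈ K := Submodule.one_le.mp hK.one_le
  obtain ⟨ι, _, f, hf⟩ := (isSyzygyOfMCM_iff hcm hc).mp h
  obtain ⟨u, huI, hu⟩ := hreg.exists_isUnit (Q := Q)
  have huω : u ∈ K / Subalgebra.toSubmodule A := by
    refine Submodule.mem_div_iff_forall_mul_mem.mpr fun a ha => hK.one_le ?_
    obtain ⟨i, hi, rfl⟩ := huI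
    obtain ⟨j, -, hj⟩ := mem_colonAlgebra_iff.mp ha i hi
    exact Submodule.mem_one.mpr ⟨j, hj.trans (mul_comm _ _)⟩
  -- `ω` contains its bidual `R : (R : ω)`.
  have hω : ∀ q : Q, (∀ t, (∀ b ∈ K / Subalgebra.toSubmodule A, t * b ∈ (1 : Submodule R Q)) →
      q * t ∈ (1 : Submodule R Q)) → q ∈ K / Subalgebra.toSubmodule A := fun q hq =>
    mem_of_isSaturatedEmbedding (A := R)
      (X := (canonicalColon A K).restrictScalars R) hu huω hf fun p hp =>
        Submodule.mem_one.mp (hq p fun b hb => Submodule.mem_one.mpr (hp b hb))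
  have hXA : K * (Subalgebra.toSubmodule A / K) ≤ Subalgebra.toSubmodule A := by
    rw [mul_comm]
    exact Submodule.le_div_iff_mul_le.mp le_rfl
  obtain ⟨r, hr, hrK⟩ := exists_smul_mem_one_of_fg hK.fg
  have hrX : algebraMap R Q r ∈ K * (Subalgebra.toSubmodule A / K) := by
    rw [← one_mul (algebraMap R Q r)]
    refine Submodule.mul_mem_mul h1K (Submodule.mem_div_iff_forall_mul_mem.mpr fun k hk => ?_)
    obtain ⟨b, hb⟩ := hrK k hk
    rw [← Algebra.smul_def, hb]
    exact A.algebraMap_mem b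
  -- As `K (A : K)` is reflexive with respect to `K`, it contains `1` if `K : K (A : K) ⊆ K`.
  refine hK.mem_of_forall hdim (fg_of_isUnit_mul_mem hAfg isUnit_one fun x hx => by
    rw [one_mul]
    exact hXA hx) (isUnit_algebraMap_of_mem_nonZeroDivisors Q hr) hrX
    (Submodule.mem_div_iff_forall_mul_mem.mpr fun p hp => ?_)
  rw [one_mul]
  -- It remains to see that `K : K (A : K)` is contained in the bidual of `ω`: any `t ∈ R : ω`
  -- satisfies `t K ⊆ K : ω = A`.
  suffices hpω : p ∈ K / Subalgebra.toSubmodule A by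
    simpa using Submodule.mem_div_iff_forall_mul_mem.mp hpω 1 (one_mem A)
  refine hω p fun t ht => hK.div_self_le hdim fun k hk => ?_
  rw [mul_assoc, mul_comm t]
  refine Submodule.mem_div_iff_forall_mul_mem.mp hp _ (Submodule.mul_mem_mul hk
    (Submodule.mem_div_iff_forall_mul_mem.mpr fun k' hk' => ?_))
  refine hK.mem_of_forall hdim hAfg isUnit_one (one_mem A)
    (Submodule.mem_div_iff_forall_mul_mem.mpr fun b hb => ?_)
  obtain ⟨a, ha⟩ := Submodule.mem_one.mp (ht b hb)
  rw [mul_right_comm, ← ha, ← Algebra.smul_def]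
  exact K.smul_mem a hk'

/-- If `K ⊆ A = I : I`, then a finite generating set of the linear forms from an MCM `A`-module into
`K` embeds the module in a free `R`-module: the forms have values in `R`, and they detect
divisibility. -/
theorem cmCat_le_omegaCMTraceCat (hK : IsFractionalCanonicalIdeal K)
    (hdim : ringKrullDim R = 1) (hcm : c ∈ IsLocalRing.maximalIdeal R)
    (hc : c ∈ nonZeroDivisors R) (hreg : IsRegularIdeal I) (hrefl : Module.IsReflexive R I)
    (htr : IsTraceIdeal I) (hKA : K ≤ Subalgebra.toSubmodule (colonAlgebra Q I)) :
    CMCat R (colonAlgebra Q I) ≤ OmegaCMTraceCat R I := by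
  rintro M ⟨_, _, hM⟩
  have := module_finite_colonAlgebra (Q := Q) hreg
  obtain ⟨hMA, hMtf⟩ := (isMCM_iff hcm hc).mp hM
  have hMR : Module.Finite R M := Module.Finite.trans (colonAlgebra Q I) M
  have : Module.Finite R K := Module.Finite.iff_fg.mpr hK.fg
  refine ⟨(isSyzygyOfMCM_iff hcm hc).mpr ?_, moduleTrace_le_iff.mpr fun φ m =>
    apply_mem_of_isReflexive (Q := Q) hreg hrefl htr φ m⟩
  -- A linear form into `K` takes values `x` with `x A ⊆ K`, so that `x K ⊆ K` and `x ∈ K : K = R`.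
  have hval : ∀ (φ : M →ₗ[R] K) (m : M), ∃ b, algebraMap R Q b = φ m := fun φ m =>
    Submodule.mem_one.mp (hK.div_self_le hdim fun k hk => by
      have := map_smul_of_isTorsionFree (S := colonAlgebra Q I) (K.subtype ∘ₗ φ) ⟨k, hKA hk⟩ m
      rw [mul_comm]
      exact (show K.subtype _ = k * (φ m : Q) from this) ▸ Subtype.prop _)
  obtain ⟨n, s, hs⟩ := Submodule.fg_iff_exists_fin_generating_family.mp
    (Module.finite_def.mp (inferInstance : Module.Finite R (M →ₗ[R] K)))
  choose f hf using fun j => exists_linearMap_algebraMap_eq (K.subtype ∘ₗ s j) (hval (s j))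
  -- If all generating forms have values in `rK` at `m`, then `m` is divisible by `r`.
  have hdiv : ∀ r ∈ nonZeroDivisors R, ∀ m : M, (∀ j, ∃ k : K, r • k = s j m) →
      ∃ m', r • m' = m := by
    intro r hr m h
    refine hK.exists_smul_eq hdim hr fun φ => ?_
    have hle : Submodule.span R (Set.range s) ≤
        Submodule.comap (LinearMap.applyₗ m) (LinearMap.range (LinearMap.lsmul R K r)) := by
      rw [Submodule.span_le]
      rintro _ ⟨j, rfl⟩
      exact h j
    exact hle (hs ▸ Submodule.mem_top)
  refine ⟨Fin n, inferInstance, LinearMap.pi f, ?_, fun r hr w m hw => ?_⟩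
  -- The common kernel of the forms is divisible by `c`, so it is zero by Nakayama.
  · rw [← LinearMap.ker_eq_bot]
    refine Submodule.eq_bot_of_le_smul_of_le_jacobson_bot (Ideal.span {c}) _
      (IsNoetherian.noetherian _) (fun m hm => ?_) ?_
    · have hm0 : ∀ j, s j m = 0 := fun j => Subtype.ext (by
        have := hf j m
        rw [show f j m = 0 from congrFun hm j, map_zero] at this
        exact this.symm)
      obtain ⟨m', rfl⟩ := hdiv c hc m fun j => ⟨0, by rw [hm0, smul_zero]⟩
      refine Submodule.smul_mem_smul (Ideal.mem_span_singleton_self c) ?_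
      refine LinearMap.mem_ker.mpr (smul_right_cancel_of_mem_nonZeroDivisors hc ?_)
      rw [← map_smul, smul_zero]
      exact hm
    · rw [IsLocalRing.jacobson_eq_maximalIdeal _ bot_ne_top]
      exact (Ideal.span_singleton_le_iff_mem _).mpr hcm
  · obtain ⟨m', rfl⟩ := hdiv r hr m fun j => ⟨⟨algebraMap R Q (w j),
      hK.one_le (Submodule.mem_one.mpr ⟨_, rfl⟩)⟩, Subtype.ext (by
        refine Eq.trans ?_ (hf j m)
        rw [← show r • w j = f j m from congrFun hw j, smul_eq_mul, map_mul]
        exact Algebra.smul_def _ _)⟩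
    exact ⟨m', smul_right_cancel_of_mem_nonZeroDivisors hr (by rw [hw, map_smul])⟩

theorem omegaCMTraceCat_eq_cmCat_iff (hK : IsFractionalCanonicalIdeal K)
    (hdim : ringKrullDim R = 1) (hcm : c ∈ IsLocalRing.maximalIdeal R)
    (hc : c ∈ nonZeroDivisors R) (hreg : IsRegularIdeal I) (hrefl : Module.IsReflexive R I)
    (htr : IsTraceIdeal I) :
    OmegaCMTraceCat R I = CMCat R (colonAlgebra Q I) ↔
      K ≤ Subalgebra.toSubmodule (colonAlgebra Q I) := by
  refine ⟨fun h => ?_, fun h => le_antisymm (omegaCMTraceCat_le_cmCat hcm hc hreg)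
    (cmCat_le_omegaCMTraceCat hK hdim hcm hc hreg hrefl htr h)⟩
  have hω := (h.symm ▸ cmCat_canonicalColon hK hcm hc hreg :
    OmegaCMTraceCat R I (ModuleCat.of R (canonicalColon (colonAlgebra Q I) K)))
  exact le_of_one_mem_mul_div hK.one_le hK.fg hK.le_integralClosure _
    (one_mem_mul_div_of_isSyzygyOfMCM hK hdim hcm hc hreg hω.1)

end

theorem theorem3p2 {R : Type u} [CommRing R] [IsLocalRing R]
    (hCM : IsCMLocalRing R) (hdim : ringKrullDim R = 1)
    {Q : Type u} [CommRing Q] [Algebra R Q] [IsFractionRing R Q] (hQ : IsGorensteinRing Q)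
    (I : Ideal R) (hreg : IsRegularIdeal I) (hrefl : Module.IsReflexive R I)
    (htr : IsTraceIdeal I) :
    -- `A` is `colonAlgebra Q I`, that is `I : I ≅ End_R(I)`
    -- (1) restriction of scalars embeds `CM(A)` in the `R`-modules as a full subcategory, and
    -- `ΩCM(A) ⊆ ΩCM(R, I) ⊆ CM(A)`
    ((∀ (M N : Type u) [AddCommGroup M] [AddCommGroup N] [Module R M] [Module R N]
        [Module (colonAlgebra Q I) M] [Module (colonAlgebra Q I) N]
        [IsScalarTower R (colonAlgebra Q I) M] [IsScalarTower R (colonAlgebra Q I) N],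
        IsMCM (colonAlgebra Q I) M → IsMCM (colonAlgebra Q I) N →
        ∀ (f : M →ₗ[R] N) (a : colonAlgebra Q I) (x : M), f (a • x) = a • f x) ∧
      OmegaCMCat R (colonAlgebra Q I) ≤ OmegaCMTraceCat R I ∧
      OmegaCMTraceCat R I ≤ CMCat R (colonAlgebra Q I)) ∧
    -- (2)
    (OmegaCMCat R (colonAlgebra Q I) = OmegaCMTraceCat R I ↔ IsStableIdeal Q I) ∧
    -- (3) with `S = R[K]` and `𝔠 = R : S`
    (∀ K : Submodule R Q, IsFractionalCanonicalIdeal K →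
      (OmegaCMTraceCat R I = CMCat R (colonAlgebra Q I) ↔
        IsLocalization.coeSubmodule Q I ≤
          1 / Subalgebra.toSubmodule (Algebra.adjoin R (K : Set Q))) ∧
      (IsLocalization.coeSubmodule Q I ≤
          1 / Subalgebra.toSubmodule (Algebra.adjoin R (K : Set Q)) ↔
        IsLocalization.coeSubmodule Q I * K = IsLocalization.coeSubmodule Q I)) := by
  have := hCM.noetherian
  have : Ring.KrullDimLE 1 R := (Order.krullDimLE_iff 1 _).mpr hdim.le
  obtain ⟨c, hcm, hc⟩ := hCM.exists_mem_maximalIdeal hdim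
  have := module_finite_colonAlgebra (Q := Q) hreg
  refine ⟨⟨?_, omegaCMCat_le_omegaCMTraceCat hcm hc hreg hrefl htr,
    omegaCMTraceCat_le_cmCat hcm hc hreg⟩,
    omegaCMCat_eq_omegaCMTraceCat_iff hcm hc hreg hrefl htr, fun K hK => ⟨?_, ?_⟩⟩
  · intro M N _ _ _ _ _ _ _ _ _ hN f a x
    have := ((isMCM_iff hcm hc).mp hN).2
    exact map_smul_of_isTorsionFree f a x
  · rw [coeSubmodule_le_one_div_iff htr]
    exact omegaCMTraceCat_eq_cmCat_iff hK hdim hcm hc hreg hrefl htr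
  · rw [coeSubmodule_le_one_div_iff htr, coeSubmodule_mul_eq_iff hK.one_le]
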